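/- \textbf{Setting.} Let $n\in\{2,3\}$. A bounded connected open porous medium $Y\subset\mathbb R^n$, with $\partial Y=\partial_DY\cup\partial_NY$ (disjoint, $\partial_DY$ of positive measure), is decomposed into finitely many pairwise disjoint connected flat subdomains $\Omega_i$ of dimensions $d_i\in\{0,\dots,n\}$ (matrix components, fractures, intersections). Each one-sided contact of an $\Omega_i$ with an $\Omega_j$, $d_j=d_i+1$, is an interface $\Gamma_J$, coinciding with $\Omega_i$ and with unit normal $\nu$ pointing out of $\Omega_j$. Each $\Omega_i$ carries a symmetric positive definite tangential permeability tensor $K$, and each $\Gamma_J$ an aperture $\gamma>0$ and a normal permeability $K_\nu>0$; these are constant on each subdomain, respectively interface. The $\Omega_i$ and the $\Gamma_J$ are triangulated by simplices; meshes of different subdomains and the mortar meshes need not match. $V_h$ is the lowest-order Raviart--Thomas space on all subdomains, with zero normal flux on $\partial_NY$ and at fracture tips; $V_{0h}\subset V_h$ is the subspace with zero normal flux on the interfaces; $\Lambda_h$, $Q_h$ are the piecewise constants on the mortar meshes and on the subdomain meshes; $W_h=V_{0h}\times\Lambda_h$. The extension $R_h:\Lambda_h\to V_h$ is a linear map such that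 the normal component of $R_h\mu$ on the interfaces is the $L^2$-projection of $\mu$ to the normal traces of $V_h$, and $0$ on the remaining boundary. With $\llbracket\mu\rrbracket|_{\Omega_i}=-\sum_{J:\,\Gamma_J=\Omega_i}\mu|_{\Gamma_J}$ put, for $w=[u,\lambda]$, $r=[v,\mu]\in W_h$ and $p\in Q_h$, \begin{align*} a(w,r)&=(K^{-1}(u+R_h\lambda),v+R_h\mu)_\Omega+(\gamma K_\nu^{-1}\lambda,\mu)_\Gamma,\\ b(r,p)&=-(p,\nabla\cdot(v+R_h\mu)+\llbracket\mu\rrbracket)_\Omega,\\ a^D(w,r)&=\sum_T\sum_{f\subset\partial T}\bigl((u+R_h\lambda)\cdot\nu_f\bigr)\bigl((v+R_h\mu)\cdot\nu_f\bigr)(K^{-1}\phi_f,\phi_f)_T+(\gamma K_\nu^{-1}\lambda,\mu)_\Gamma, \end{align*} where $T$ runs over the elements of the subdomain meshes and $\phi_f$ is the Raviart--Thomas basis field of the face $f$ of $T$. Let $A,D_A:W_h\to W_h'$ and $B:W_h\to Q_h'$ be the operators of $a,a^D,b$; let $X=W_h\times Q_h$, $\|w\|_A^2=\langle Aw,w\rangle$,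 $\|w\|_{D_A}^2=\langle D_Aw,w\rangle$. For symmetric positive definite $H_w:W_h'\to W_h$ and $H_p:Q_h'\to Q_h$ let $$\mathcal A=\begin{pmatrix}A&B^T\\-B&0\end{pmatrix},\quad \mathcal M_D=\begin{pmatrix}H_w&0\\0&H_p\end{pmatrix},\quad \mathcal M_L=\begin{pmatrix}H_w^{-1}&0\\-B&H_p^{-1}\end{pmatrix}^{-1},$$ $(x,y)_{\mathcal M_D^{-1}}=\langle\mathcal M_D^{-1}x,y\rangle$ and $\|x\|_{\mathcal M_D^{-1}}^2=(x,x)_{\mathcal M_D^{-1}}$. \textbf{Theorem.} For every $\sigma$ there is $c_2>0$, and for every $\kappa$ there is $c_1>0$ (depending only on $n,\sigma$ and on $n,\sigma,\kappa$, respectively), such that the following holds for all geometries, meshes, parameters and extensions as above for which each element $T$ of the subdomain meshes contains a ball (of its affine hull) of some radius $r_T>0$ with $\operatorname{diam}T\le\sigma r_T$, and for which on each subdomain the ratio of the largest to the smallest eigenvalue of the tangential permeability is at most $\kappa$ ($\kappa=1$ for scalar permeabilities). First, $c_1\|r\|_{D_A}\le\|r\|_A\le c_2\|r\|_{D_A}$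 for all $r\in W_h$. Second, let $c_{1,w},c_{2,w},c_{1,p},c_{2,p}>0$ and $0\le\rho<1$, and let $H_w,H_p$ be symmetric positive definite with \begin{align*} c_{1,w}\langle f,H_wf\rangle&\le\langle f,A^{-1}f\rangle\le c_{2,w}\langle f,H_wf\rangle&&(f\in W_h'),\\ c_{1,p}\langle g,H_pg\rangle&\le\langle g,(BD_A^{-1}B^T)^{-1}g\rangle\le c_{2,p}\langle g,H_pg\rangle&&(g\in Q_h'), \end{align*} and $\|I-H_wA\|_A\le\rho$. Then $\mathcal M_L$ is FOV-equivalent to $\mathcal A$ in the $\mathcal M_D^{-1}$ inner product: for every $x\in X$, $x\ne0$, $$\xi_1\le\frac{(\mathcal M_L\mathcal Ax,x)_{\mathcal M_D^{-1}}}{(x,x)_{\mathcal M_D^{-1}}},\qquad \frac{\|\mathcal M_L\mathcal Ax\|_{\mathcal M_D^{-1}}}{\|x\|_{\mathcal M_D^{-1}}}\le\xi_2,$$ with the positive constants $$\xi_1=\tfrac{1-\rho}2\min\{c_{2,w}^{-1},\;c_{2,w}^{-1}c_2^{-2}c_{2,p}^{-1}\},\qquad \xi_2=\max\{2c_{1,w}^{-1},\;c_{1,p}^{-1}c_1^{-2}(1+c_{1,w}^{-1})\}.$$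 -/

import Mathlib

open MeasureTheory

namespace MixedDim

noncomputable section

/-! ### Inverses of linear maps and simplices -/

/-- The inverse of a bijective linear map; by convention `0` if the map is not bijective. -/
def linInv {E F : Type*} [AddCommGroup E] [Module ℝ E] [AddCommGroup F] [Module ℝ F]
    (L : E →ₗ[ℝ] F) : F →ₗ[ℝ] E :=
  open Classical in
  if h : Function.Bijective L then ((LinearEquiv.ofBijective L h).symm : F →ₗ[ℝ] E) else 0

/-- Points of the ambient Euclidean space. -/
abbrev Pt (n : ℕ) := EuclideanSpace ℝ (Fin n)

/-- Nondegenerate `d`-simplices in `ℝⁿ`. -/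
abbrev Simp (n d : ℕ) := Affine.Simplex ℝ (Pt n) d

section Simplices

variable {n d : ℕ}

/-- The relative interior of a simplex (the point itself if `d = 0`). -/
def relInt (T : Simp n d) : Set (Pt n) := T.setInterior (Set.Ioi 0)

/-- The relative interior of the face of `T` opposite to the vertex `k` (empty if `d = 0`). -/
def faceInt (T : Simp n d) (k : Fin (d + 1)) : Set (Pt n) :=
  {x | ∃ w : Fin (d + 1) → ℝ, w k = 0 ∧ (∀ l, l ≠ k → 0 < w l) ∧ ∑ l, w l = 1 ∧
    x = ∑ l, w l • T.points l}

/-- The distance from the vertex `k` to the hyperplane spanned by the opposite face. -/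
def height (T : Simp n d) (k : Fin (d + 1)) : ℝ :=
  Metric.infDist (T.points k) (affineSpan ℝ (T.points '' {k}ᶜ) : Set (Pt n))

/-- The lowest-order Raviart-Thomas basis field of the face opposite to the vertex `k`:
its outer normal component is `1` on that face and `0` on the other faces. -/
def rtBasis (T : Simp n d) (k : Fin (d + 1)) (x : Pt n) : Pt n :=
  (height T k)⁻¹ • (x - T.points k)

/-- The (tangential) divergence of `rtBasis T k`. -/
def rtDiv (T : Simp n d) (k : Fin (d + 1)) : ℝ := (d : ℝ) * (height T k)⁻¹

/-- Shape regularity: the diameter is at most `σ` times the radius of a ball of the affine hull of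
`T` that is contained in `T`. -/
def ShapeRegular (σ : ℝ) (T : Simp n d) : Prop :=
  ∃ c ∈ affineSpan ℝ (Set.range T.points), ∃ r : ℝ, 0 < r ∧
    Metric.closedBall c r ∩ (affineSpan ℝ (Set.range T.points) : Set (Pt n)) ⊆ T.closedInterior ∧
    Metric.diam T.closedInterior ≤ σ * r

theorem isCompact_closedInterior (T : Simp n d) : IsCompact T.closedInterior := by
  rw [← Affine.Simplex.convexHull_eq_closedInterior]
  exact (Set.finite_range _).isCompact_convexHull ℝ

theorem measure_closedInterior_lt_top (T : Simp n d) :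
    (μHE[d] : Measure (Pt n)) T.closedInterior < ⊤ := by
  set V := vectorSpan ℝ (Set.range T.points) with hV
  have hd : Module.finrank ℝ V = d := T.independent.finrank_vectorSpan (by simp)
  let f : V → Pt n := fun v => (v : Pt n) + T.points 0
  have hf : Isometry f := by
    refine Isometry.of_dist_eq fun a b => ?_
    simp [f, Subtype.dist_eq]
  have himg : f '' (f ⁻¹' T.closedInterior) = T.closedInterior := by
    rw [Set.image_preimage_eq_iff]
    intro x hx
    have hx' := T.closedInterior_subset_affineSpan hx
    have h0 : T.points 0 ∈ affineSpan ℝ (Set.range T.points) :=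
      subset_affineSpan ℝ _ (Set.mem_range_self 0)
    have := AffineSubspace.vsub_mem_direction hx' h0
    rw [direction_affineSpan] at this
    exact ⟨⟨_, this⟩, by simp [f]⟩
  have hc : IsCompact (f ⁻¹' T.closedInterior) :=
    hf.isClosedEmbedding.isCompact_preimage (isCompact_closedInterior T)
  have hvol : (μHE[d] : Measure V) = volume := by
    rw [← InnerProductSpace.euclideanHausdorffMeasure_eq_volume, hd]
  rw [← himg, hf.euclideanHausdorffMeasure_image, hvol]
  exact hc.measure_lt_top

theorem isFiniteMeasure_restrict (T : Simp n d) :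
    IsFiniteMeasure ((μHE[d] : Measure (Pt n)).restrict T.closedInterior) :=
  ⟨by simpa using measure_closedInterior_lt_top T⟩

theorem integrableOn_of_continuous (T : Simp n d) {f : Pt n → ℝ} (hf : Continuous f) :
    IntegrableOn f T.closedInterior (μHE[d] : Measure (Pt n)) := by
  have := isFiniteMeasure_restrict T
  exact hf.continuousOn.integrableOn_of_subset_isCompact (isCompact_closedInterior T)
    (isCompact_closedInterior T).measurableSet subset_rfl (measure_closedInterior_lt_top T).ne

end Simplices

/-! ### Mixed-dimensional geometry -/

/-- Moving from `x` a small distance against the direction `ν` one is in `D`. -/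
def ReachedFrom {n : ℕ} (D : Set (Pt n)) (ν x : Pt n) : Prop :=
  ∃ ε > 0, ∀ t ∈ Set.Ioo (0 : ℝ) ε, x - t • ν ∈ D

/-- A porous medium `Y ⊂ ℝⁿ` decomposed into finitely many pairwise disjoint flat subdomains
`Ω i` of dimension `dim i`: the components of the matrix (dimension `n`), the fractures
(dimension `n - 1`), and their intersections (lower dimensions). -/
structure Geometry (n : ℕ) where
  /-- the porous medium -/
  Y : Set (Pt n)
  isOpen_Y : IsOpen Y
  isConnected_Y : IsConnected Y
  isBounded_Y : Bornology.IsBounded Y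
  /-- the Dirichlet part of the outer boundary -/
  bdryD : Set (Pt n)
  /-- the Neumann part of the outer boundary -/
  bdryN : Set (Pt n)
  bdry_union : bdryD ∪ bdryN = frontier Y
  bdry_disjoint : Disjoint bdryD bdryN
  bdryD_pos : 0 < (μHE[n - 1] : Measure (Pt n)) bdryD
  /-- the index set of all subdomains, of all dimensions -/
  I : Type
  [finI : Fintype I]
  dim : I → ℕ
  dim_le : ∀ i, dim i ≤ n
  Ω : I → Set (Pt n)
  Ω_subset : ∀ i, Ω i ⊆ Y
  Ω_connected : ∀ i, IsConnected (Ω i)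
  Ω_dim : ∀ i, Module.finrank ℝ (vectorSpan ℝ (Ω i)) = dim i
  Ω_relOpen : ∀ i, ∃ U : Set (Pt n), IsOpen U ∧ Ω i = U ∩ (affineSpan ℝ (Ω i) : Set (Pt n))
  Ω_disjoint : Pairwise fun i j => Disjoint (Ω i) (Ω j)
  /-- the matrix components fill the medium -/
  matrix_cover : Y ⊆ ⋃ (i) (_ : dim i = n), closure (Ω i)
  /-- what is removed from the matrix is made of fractures (and their intersections) -/
  fracture_cover : Y \ (⋃ (i) (_ : dim i = n), Ω i) ⊆ ⋃ (i) (_ : dim i + 1 = n), closure (Ω i)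
  /-- every lower-dimensional subdomain bounds some subdomain of one dimension more -/
  hierarchy : ∀ i, dim i < n → ∃ j, dim j = dim i + 1 ∧ Ω i ⊆ closure (Ω j)
  /-- a subdomain that lies on one side of a lower-dimensional one somewhere does so everywhere -/
  side_uniform : ∀ i j ν, dim j = dim i + 1 → ν ∈ vectorSpan ℝ (Ω j) →
    (∀ v ∈ vectorSpan ℝ (Ω i), inner ℝ ν v = 0) →
    ∀ x ∈ Ω i, ReachedFrom (Ω j) ν x → ∀ y ∈ Ω i, ReachedFrom (Ω j) ν y

attribute [instance] Geometry.finI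

/-- An interface: it coincides with a subdomain `Ω low`, seen as a part of the boundary of a
subdomain `Ω high` of one dimension more; `normal` is the unit normal on it, tangential to
`Ω high` and pointing out of `Ω high`.  A subdomain that touches `Ω low` from two sides gives
two interfaces. -/
structure Interface {n : ℕ} (G : Geometry n) where
  low : G.I
  high : G.I
  normal : Pt n
  dim_high : G.dim high = G.dim low + 1
  norm_normal : ‖normal‖ = 1
  normal_mem : normal ∈ vectorSpan ℝ (G.Ω high)
  normal_orth : ∀ v ∈ vectorSpan ℝ (G.Ω low), inner ℝ normal v = 0
  reached : ∀ x ∈ G.Ω low, ReachedFrom (G.Ω high) normal x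

/-- The face of the simplex `T` (of a triangulation of `Ω i`) opposite to its vertex `k` lies on
the interface `J`. -/
def FaceOn {n : ℕ} {G : Geometry n} (i : G.I) (T : Simp n (G.dim i)) (k : Fin (G.dim i + 1))
    (J : Interface G) : Prop :=
  i = J.high ∧ faceInt T k ⊆ G.Ω J.low ∧
    ∀ l, l ≠ k → inner ℝ (T.points k - T.points l) J.normal < 0

/-- Triangulations of all subdomains and of all interfaces (mortar meshes).  The meshes of
different subdomains and the mortar meshes need not match. -/
structure Mesh {n : ℕ} (G : Geometry n) where
  /-- the elements of the subdomain meshes -/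
  E : Type
  [finE : Fintype E]
  /-- the subdomain to which an element belongs -/
  sub : E → G.I
  T : ∀ e, Simp n (G.dim (sub e))
  T_subset : ∀ e, relInt (T e) ⊆ G.Ω (sub e)
  T_cover : ∀ i, closure (G.Ω i) = ⋃ (e) (_ : sub e = i), (T e).closedInterior
  T_disjoint : ∀ e e', e ≠ e' → sub e = sub e' → Disjoint (relInt (T e)) (relInt (T e'))
  /-- inside the subdomain two elements meet in a common face -/
  T_conforming : ∀ e e', e ≠ e' → sub e = sub e' →
    (T e).closedInterior ∩ (T e').closedInterior ∩ G.Ω (sub e) ⊆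
      convexHull ℝ (Set.range (T e).points ∩ Set.range (T e').points)
  /-- each face is inside the subdomain, or on an interface, or on the Dirichlet part or the
  Neumann part of the outer boundary, or on a fracture tip -/
  face_resolved : ∀ e k, faceInt (T e) k ⊆ G.Ω (sub e) ∨ (∃ J, FaceOn (sub e) (T e) k J) ∨
    faceInt (T e) k ⊆ G.bdryD ∨ faceInt (T e) k ⊆ G.bdryN ∨
    faceInt (T e) k ⊆ G.Y \ (G.Ω (sub e) ∪ ⋃ (i) (_ : G.dim i + 1 = G.dim (sub e)), G.Ω i)
  /-- the elements of the mortar meshes -/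
  M : Type
  [finM : Fintype M]
  /-- the interface to which a mortar element belongs -/
  ifc : M → Interface G
  S : ∀ m, Simp n (G.dim (ifc m).low)
  S_subset : ∀ m, relInt (S m) ⊆ G.Ω (ifc m).low
  S_cover : ∀ J : Interface G, closure (G.Ω J.low) = ⋃ (m) (_ : ifc m = J), (S m).closedInterior
  S_disjoint : ∀ m m', m ≠ m' → ifc m = ifc m' → Disjoint (relInt (S m)) (relInt (S m'))
  S_conforming : ∀ m m', m ≠ m' → ifc m = ifc m' →
    (S m).closedInterior ∩ (S m').closedInterior ∩ G.Ω (ifc m).low ⊆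
      convexHull ℝ (Set.range (S m).points ∩ Set.range (S m').points)

attribute [instance] Mesh.finE Mesh.finM

/-- The physical parameters: the permeability tensor `K i` of each subdomain (only its action on
the tangent space of `Ω i` matters), and the distance `γ` (aperture) and the normal permeability
`Kν` of each interface. -/
structure Params {n : ℕ} (G : Geometry n) where
  K : G.I → (Pt n →ₗ[ℝ] Pt n)
  K_symm : ∀ i x y, inner ℝ (K i x) y = inner ℝ x (K i y)
  K_pos : ∀ i x, x ≠ 0 → 0 < inner ℝ (K i x) x
  K_tangential : ∀ i, ∀ x ∈ vectorSpan ℝ (G.Ω i), K i x ∈ vectorSpan ℝ (G.Ω i)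
  γ : Interface G → ℝ
  γ_pos : ∀ J, 0 < γ J
  Kν : Interface G → ℝ
  Kν_pos : ∀ J, 0 < Kν J

/-- On each subdomain the ratio of the largest to the smallest tangential permeability is at most
`κ`.  For scalar permeabilities `κ = 1` is allowed. -/
def Params.AnisotropyLE {n : ℕ} {G : Geometry n} (P : Params G) (κ : ℝ) : Prop :=
  ∀ i, ∃ m > 0, ∀ x ∈ vectorSpan ℝ (G.Ω i),
    m * ‖x‖ ^ 2 ≤ inner ℝ (P.K i x) x ∧ inner ℝ (P.K i x) x ≤ κ * m * ‖x‖ ^ 2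

/-! ### Discrete spaces -/

namespace Mesh

variable {n : ℕ} {G : Geometry n} (𝓣 : Mesh G)

/-- Pairs of an element and one of its faces (named by the opposite vertex). -/
abbrev Face := Σ e : 𝓣.E, Fin (G.dim (𝓣.sub e) + 1)

/-- The relative interior of a face. -/
def fInt (f : 𝓣.Face) : Set (Pt n) := faceInt (𝓣.T f.1) f.2

/-- The face lies on the interface `J` and is seen from the side of `J`. -/
def On (f : 𝓣.Face) (J : Interface G) : Prop := FaceOn (𝓣.sub f.1) (𝓣.T f.1) f.2 J

/-- The face lies inside its subdomain. -/
def IsInner (f : 𝓣.Face) : Prop := 𝓣.fInt f ⊆ G.Ω (𝓣.sub f.1)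

/-- The lowest-order Raviart-Thomas flux space on all subdomains of positive dimension.  A
piecewise Raviart-Thomas field is given by its outer normal components on the faces of the
elements.  These add up to zero on two sides of an inner face (normal continuity), and they
vanish on the Neumann boundary and at fracture tips. -/
def V : Submodule ℝ (𝓣.Face → ℝ) where
  carrier := {α |
    (∀ f, G.dim (𝓣.sub f.1) = 0 → α f = 0) ∧
    (∀ f f', f ≠ f' → 𝓣.sub f.1 = 𝓣.sub f'.1 → 𝓣.fInt f = 𝓣.fInt f' → 𝓣.IsInner f →
      α f + α f' = 0) ∧
    (∀ f, ¬ 𝓣.IsInner f → (¬ ∃ J, 𝓣.On f J) → ¬ 𝓣.fInt f ⊆ G.bdryD → α f = 0)}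
  add_mem' := by
    rintro α β ⟨h1, h2, h3⟩ ⟨k1, k2, k3⟩
    refine ⟨fun f h => ?_, fun f f' a b c d => ?_, fun f a b c => ?_⟩
    · simp [h1 f h, k1 f h]
    · have := h2 f f' a b c d
      have := k2 f f' a b c d
      simp only [Pi.add_apply]
      linarith
    · simp [h3 f a b c, k3 f a b c]
  zero_mem' := by simp
  smul_mem' := by
    rintro r α ⟨h1, h2, h3⟩
    refine ⟨fun f h => ?_, fun f f' a b c d => ?_, fun f a b c => ?_⟩
    · simp [h1 f h]
    · have := h2 f f' a b c d
      simp only [Pi.smul_apply, smul_eq_mul]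
      rw [← mul_add, this, mul_zero]
    · simp [h3 f a b c]

/-- The fluxes with zero normal component on all interfaces. -/
def V₀ : Submodule ℝ (𝓣.Face → ℝ) where
  carrier := {α | α ∈ 𝓣.V ∧ ∀ f J, 𝓣.On f J → α f = 0}
  add_mem' := by
    rintro α β ⟨h1, h2⟩ ⟨k1, k2⟩
    exact ⟨add_mem h1 k1, fun f J h => by simp [h2 f J h, k2 f J h]⟩
  zero_mem' := ⟨zero_mem _, by simp⟩
  smul_mem' := by
    rintro r α ⟨h1, h2⟩
    exact ⟨𝓣.V.smul_mem r h1, fun f J h => by simp [h2 f J h]⟩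

/-- Piecewise constant mortar functions. -/
abbrev Λ := 𝓣.M → ℝ

/-- Piecewise constant pressures. -/
abbrev Q := 𝓣.E → ℝ

/-- The flux space `V₀ × Λ`. -/
abbrev W := 𝓣.V₀ × 𝓣.Λ

/-- The value on the element `e` of the piecewise Raviart-Thomas field with normal components
`α`. -/
def field (α : 𝓣.Face → ℝ) (e : 𝓣.E) (x : Pt n) : Pt n :=
  ∑ k, α ⟨e, k⟩ • rtBasis (𝓣.T e) k x

/-- The divergence on the element `e` of the field with normal components `α`. -/
def divg (α : 𝓣.Face → ℝ) (e : 𝓣.E) : ℝ := ∑ k, α ⟨e, k⟩ * rtDiv (𝓣.T e) k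

open Classical in
/-- The mortar function `μ` on the interface `J`. -/
def mortar (μ : 𝓣.Λ) (J : Interface G) (x : Pt n) : ℝ :=
  ∑ m with 𝓣.ifc m = J, (𝓣.S m).closedInterior.indicator (fun _ => μ m) x

open Classical in
/-- The jump of a mortar function on the subdomain `Ω i`: minus the sum of its values on all
interfaces that coincide with `Ω i`. -/
def jump (μ : 𝓣.Λ) (i : G.I) (x : Pt n) : ℝ :=
  -∑ m with (𝓣.ifc m).low = i, (𝓣.S m).closedInterior.indicator (fun _ => μ m) x

open Classical in
/-- `R` is a discrete extension operator: the normal component of `R μ` is the `L²` projection of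
`μ` to the normal traces of `V` on the interfaces, and zero on the remaining boundary. -/
def IsExtension (R : 𝓣.Λ →ₗ[ℝ] 𝓣.V) : Prop :=
  (∀ (μ : 𝓣.Λ) (J : Interface G) (v : 𝓣.V),
    ∑ f with 𝓣.On f J, ∫ x in 𝓣.fInt f,
      ((R μ : 𝓣.Face → ℝ) f - 𝓣.mortar μ J x) * (v : 𝓣.Face → ℝ) f ∂(μHE[G.dim J.low]) = 0) ∧
  ∀ (μ : 𝓣.Λ) (f : 𝓣.Face), ¬ 𝓣.IsInner f → (¬ ∃ J, 𝓣.On f J) → (R μ : 𝓣.Face → ℝ) f = 0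

theorem field_add (α β : 𝓣.Face → ℝ) (e : 𝓣.E) (x : Pt n) :
    𝓣.field (α + β) e x = 𝓣.field α e x + 𝓣.field β e x := by
  simp [field, add_smul, Finset.sum_add_distrib]

theorem field_smul (c : ℝ) (α : 𝓣.Face → ℝ) (e : 𝓣.E) (x : Pt n) :
    𝓣.field (c • α) e x = c • 𝓣.field α e x := by
  simp [field, mul_smul, Finset.smul_sum]

theorem continuous_field (α : 𝓣.Face → ℝ) (e : 𝓣.E) : Continuous (𝓣.field α e) := by
  unfold field rtBasis
  fun_prop

theorem divg_add (α β : 𝓣.Face → ℝ) (e : 𝓣.E) :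
    𝓣.divg (α + β) e = 𝓣.divg α e + 𝓣.divg β e := by
  simp [divg, add_mul, Finset.sum_add_distrib]

theorem divg_smul (c : ℝ) (α : 𝓣.Face → ℝ) (e : 𝓣.E) :
    𝓣.divg (c • α) e = c * 𝓣.divg α e := by
  simp [divg, mul_assoc, Finset.mul_sum]

theorem jump_add (μ ν : 𝓣.Λ) (i : G.I) (x : Pt n) :
    𝓣.jump (μ + ν) i x = 𝓣.jump μ i x + 𝓣.jump ν i x := by
  classical
  simp only [jump, Set.indicator_apply, Pi.add_apply]
  rw [← neg_add, ← Finset.sum_add_distrib]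
  congr 1
  refine Finset.sum_congr rfl fun m _ => ?_
  split_ifs <;> simp

theorem jump_smul (c : ℝ) (μ : 𝓣.Λ) (i : G.I) (x : Pt n) :
    𝓣.jump (c • μ) i x = c * 𝓣.jump μ i x := by
  classical
  simp only [jump, Set.indicator_apply, Pi.smul_apply, smul_eq_mul]
  rw [mul_neg, Finset.mul_sum]
  congr 1
  refine Finset.sum_congr rfl fun m _ => ?_
  split_ifs <;> simp

theorem integrableOn_jump (μ : 𝓣.Λ) (i : G.I) (e : 𝓣.E) :
    IntegrableOn (𝓣.jump μ i) (𝓣.T e).closedInterior (μHE[G.dim (𝓣.sub e)]) := by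
  have := isFiniteMeasure_restrict (𝓣.T e)
  unfold jump
  refine (integrable_finsetSum _ fun m _ => ?_).neg
  exact (integrable_const _).indicator (isCompact_closedInterior _).measurableSet

end Mesh

/-! ### The discrete problem -/

/-- The discrete mixed-dimensional problem: geometry, meshes, physical parameters and a discrete
extension operator. -/
structure Problem (n : ℕ) where
  G : Geometry n
  𝓣 : Mesh G
  P : Params G
  R : 𝓣.Λ →ₗ[ℝ] 𝓣.V
  isExtension_R : 𝓣.IsExtension R

namespace Problem

variable {n : ℕ} (D : Problem n)

abbrev W := D.𝓣.W
abbrev Q := D.𝓣.Q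
/-- The dual space of the flux space. -/
abbrev W' := Module.Dual ℝ D.W
/-- The dual space of the pressure space. -/
abbrev Q' := Module.Dual ℝ D.Q

/-- The normal components of the total flux `v + R μ`. -/
def tot : D.W →ₗ[ℝ] (D.𝓣.Face → ℝ) :=
  D.𝓣.V₀.subtype.coprod (D.𝓣.V.subtype ∘ₗ D.R)

/-- The inverse permeability tensor. -/
def Kinv (i : D.G.I) : Pt n →ₗ[ℝ] Pt n := linInv (D.P.K i)

/-- The interface term `(γ Kν⁻¹ λ, μ)_Γ`. -/
def cForm (l μ : D.𝓣.Λ) : ℝ :=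
  ∑ m, ∫ _ in (D.𝓣.S m).closedInterior,
    D.P.γ (D.𝓣.ifc m) * (D.P.Kν (D.𝓣.ifc m))⁻¹ * l m * μ m ∂(μHE[D.G.dim (D.𝓣.ifc m).low])

/-- The bilinear form `a`. -/
def aForm (w r : D.W) : ℝ :=
  ∑ e, ∫ x in (D.𝓣.T e).closedInterior,
    inner ℝ (D.Kinv (D.𝓣.sub e) (D.𝓣.field (D.tot w) e x)) (D.𝓣.field (D.tot r) e x)
      ∂(μHE[D.G.dim (D.𝓣.sub e)])
  + D.cForm w.2 r.2

/-- The bilinear form `aᴰ`: on each element only the diagonal of the local mass matrix is kept. -/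
def aDForm (w r : D.W) : ℝ :=
  ∑ e, ∑ k, D.tot w ⟨e, k⟩ * D.tot r ⟨e, k⟩ *
    ∫ x in (D.𝓣.T e).closedInterior,
      inner ℝ (D.Kinv (D.𝓣.sub e) (rtBasis (D.𝓣.T e) k x)) (rtBasis (D.𝓣.T e) k x)
        ∂(μHE[D.G.dim (D.𝓣.sub e)])
  + D.cForm w.2 r.2

/-- The bilinear form `b(r, p) = -(p, div (v + R μ) + ⟦μ⟧)_Ω`. -/
def bForm (r : D.W) (p : D.Q) : ℝ :=
  -∑ e, ∫ x in (D.𝓣.T e).closedInterior,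
    p e * (D.𝓣.divg (D.tot r) e + D.𝓣.jump r.2 (D.𝓣.sub e) x) ∂(μHE[D.G.dim (D.𝓣.sub e)])

theorem cForm_add_left (l l' μ : D.𝓣.Λ) :
    D.cForm (l + l') μ = D.cForm l μ + D.cForm l' μ := by
  simp only [cForm, integral_const, smul_eq_mul, Pi.add_apply, ← Finset.sum_add_distrib]
  exact Finset.sum_congr rfl fun m _ => by ring

theorem cForm_smul_left (c : ℝ) (l μ : D.𝓣.Λ) : D.cForm (c • l) μ = c * D.cForm l μ := by
  simp only [cForm, integral_const, smul_eq_mul, Pi.smul_apply, Finset.mul_sum]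
  exact Finset.sum_congr rfl fun m _ => by ring

theorem cForm_comm (l μ : D.𝓣.Λ) : D.cForm l μ = D.cForm μ l := by
  simp only [cForm, integral_const, smul_eq_mul]
  exact Finset.sum_congr rfl fun m _ => by ring

theorem Kinv_symm (i : D.G.I) (x y : Pt n) : inner ℝ (D.Kinv i x) y = inner ℝ x (D.Kinv i y) := by
  have hinj : Function.Injective (D.P.K i) := by
    rw [injective_iff_map_eq_zero]
    intro x hx
    by_contra h
    have := D.P.K_pos i x h
    simp [hx] at this
  have hb : Function.Bijective (D.P.K i) :=
    ⟨hinj, LinearMap.surjective_of_injective hinj⟩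
  obtain ⟨u, rfl⟩ := hb.2 x
  obtain ⟨v, rfl⟩ := hb.2 y
  have key : ∀ u, D.Kinv i (D.P.K i u) = u := by
    intro u
    simp only [Kinv, linInv, hb, dif_pos]
    exact (LinearEquiv.ofBijective (D.P.K i) hb).symm_apply_apply u
  rw [key, key, D.P.K_symm]

theorem integrable_aForm (α β : D.𝓣.Face → ℝ) (e : D.𝓣.E) :
    IntegrableOn (fun x => inner ℝ (D.Kinv (D.𝓣.sub e) (D.𝓣.field α e x)) (D.𝓣.field β e x))
      (D.𝓣.T e).closedInterior (μHE[D.G.dim (D.𝓣.sub e)]) := by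
  refine integrableOn_of_continuous _ ?_
  have h1 := D.𝓣.continuous_field α e
  have h2 := D.𝓣.continuous_field β e
  have h3 : Continuous (D.Kinv (D.𝓣.sub e)) := LinearMap.continuous_of_finiteDimensional _
  exact (h3.comp h1).inner h2

theorem aForm_comm (w r : D.W) : D.aForm w r = D.aForm r w := by
  unfold aForm
  rw [D.cForm_comm]
  congr 1
  refine Finset.sum_congr rfl fun e _ => ?_
  congr 1
  funext x
  rw [D.Kinv_symm, real_inner_comm]

theorem aForm_add_left (w w' r : D.W) : D.aForm (w + w') r = D.aForm w r + D.aForm w' r := by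
  unfold aForm
  rw [Prod.snd_add, D.cForm_add_left, add_add_add_comm, ← Finset.sum_add_distrib]
  congr 1
  refine Finset.sum_congr rfl fun e _ => ?_
  rw [← integral_add (D.integrable_aForm _ _ e) (D.integrable_aForm _ _ e)]
  congr 1
  funext x
  rw [map_add, D.𝓣.field_add, map_add, inner_add_left]

theorem aForm_smul_left (c : ℝ) (w r : D.W) : D.aForm (c • w) r = c * D.aForm w r := by
  unfold aForm
  rw [Prod.smul_snd, D.cForm_smul_left, mul_add, Finset.mul_sum]
  congr 1
  refine Finset.sum_congr rfl fun e _ => ?_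
  rw [← integral_const_mul]
  congr 1
  funext x
  rw [map_smul, D.𝓣.field_smul, map_smul, real_inner_smul_left]

theorem aDForm_comm (w r : D.W) : D.aDForm w r = D.aDForm r w := by
  unfold aDForm
  rw [D.cForm_comm]
  congr 1
  refine Finset.sum_congr rfl fun e _ => Finset.sum_congr rfl fun k _ => ?_
  ring

theorem aDForm_add_left (w w' r : D.W) : D.aDForm (w + w') r = D.aDForm w r + D.aDForm w' r := by
  unfold aDForm
  rw [Prod.snd_add, D.cForm_add_left, add_add_add_comm, ← Finset.sum_add_distrib]
  congr 1
  refine Finset.sum_congr rfl fun e _ => ?_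
  rw [← Finset.sum_add_distrib]
  refine Finset.sum_congr rfl fun k _ => ?_
  rw [map_add, Pi.add_apply]
  ring

theorem aDForm_smul_left (c : ℝ) (w r : D.W) : D.aDForm (c • w) r = c * D.aDForm w r := by
  unfold aDForm
  rw [Prod.smul_snd, D.cForm_smul_left, mul_add, Finset.mul_sum]
  congr 1
  refine Finset.sum_congr rfl fun e _ => ?_
  rw [Finset.mul_sum]
  refine Finset.sum_congr rfl fun k _ => ?_
  rw [map_smul, Pi.smul_apply, smul_eq_mul]
  ring

theorem integrable_bForm (r : D.W) (p : D.Q) (e : D.𝓣.E) :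
    IntegrableOn (fun x => p e * (D.𝓣.divg (D.tot r) e + D.𝓣.jump r.2 (D.𝓣.sub e) x))
      (D.𝓣.T e).closedInterior (μHE[D.G.dim (D.𝓣.sub e)]) := by
  have := isFiniteMeasure_restrict (D.𝓣.T e)
  exact ((integrable_const _).add (D.𝓣.integrableOn_jump _ _ e)).const_mul _

/-- The operator `A : W → W'` of the form `a`. -/
def A : D.W →ₗ[ℝ] D.W' :=
  LinearMap.mk₂ ℝ D.aForm D.aForm_add_left D.aForm_smul_left
    (fun w r r' => by rw [D.aForm_comm, D.aForm_add_left, D.aForm_comm r, D.aForm_comm r'])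
    (fun c w r => by rw [D.aForm_comm, D.aForm_smul_left, D.aForm_comm r, smul_eq_mul])

/-- The operator `D_A : W → W'` of the form `aᴰ`. -/
def DA : D.W →ₗ[ℝ] D.W' :=
  LinearMap.mk₂ ℝ D.aDForm D.aDForm_add_left D.aDForm_smul_left
    (fun w r r' => by rw [D.aDForm_comm, D.aDForm_add_left, D.aDForm_comm r, D.aDForm_comm r'])
    (fun c w r => by rw [D.aDForm_comm, D.aDForm_smul_left, D.aDForm_comm r, smul_eq_mul])

/-- The operator `B : W → Q'` of the form `b`. -/
def B : D.W →ₗ[ℝ] D.Q' :=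
  LinearMap.mk₂ ℝ D.bForm
    (fun r r' p => by
      unfold bForm
      rw [← neg_add, ← Finset.sum_add_distrib]
      congr 1
      refine Finset.sum_congr rfl fun e _ => ?_
      rw [← integral_add (D.integrable_bForm _ _ e) (D.integrable_bForm _ _ e)]
      congr 1
      funext x
      rw [map_add, D.𝓣.divg_add, Prod.snd_add, D.𝓣.jump_add]
      ring)
    (fun c r p => by
      unfold bForm
      rw [smul_neg, Finset.smul_sum]
      congr 1
      refine Finset.sum_congr rfl fun e _ => ?_
      rw [smul_eq_mul, ← integral_const_mul]
      congr 1
      funext x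
      rw [map_smul, D.𝓣.divg_smul, Prod.smul_snd, D.𝓣.jump_smul]
      ring)
    (fun r p p' => by
      unfold bForm
      rw [← neg_add, ← Finset.sum_add_distrib]
      congr 1
      refine Finset.sum_congr rfl fun e _ => ?_
      rw [← integral_add (D.integrable_bForm _ _ e) (D.integrable_bForm _ _ e)]
      congr 1
      funext x
      rw [Pi.add_apply]
      ring)
    (fun c r p => by
      unfold bForm
      rw [smul_neg, Finset.smul_sum]
      congr 1
      refine Finset.sum_congr rfl fun e _ => ?_
      rw [smul_eq_mul, ← integral_const_mul]
      congr 1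
      funext x
      rw [Pi.smul_apply, smul_eq_mul]
      ring)

/-- The transpose `Bᵀ : Q → W'`. -/
def BT : D.Q →ₗ[ℝ] D.W' := D.B.flip

/-- The operator `B D_A⁻¹ Bᵀ : Q → Q'`. -/
def Schur : D.Q →ₗ[ℝ] D.Q' := D.B ∘ₗ linInv D.DA ∘ₗ D.BT

/-- The space `X = W × Q`. -/
abbrev X := D.W × D.Q

/-- The dual `X' = W' × Q'`. -/
abbrev X' := D.W' × D.Q'

/-- The duality pairing of `X'` and `X`. -/
def pair (f : D.X') (x : D.X) : ℝ := f.1 x.1 + f.2 x.2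

/-- The coefficient operator `𝒜 = [[A, Bᵀ], [-B, 0]]`. -/
def calA : D.X →ₗ[ℝ] D.X' := (D.A.coprod D.BT).prod ((-D.B).coprod 0)

/-- The block diagonal preconditioner `[[Hw, 0], [0, Hp]]`. -/
def MD (Hw : D.W' →ₗ[ℝ] D.W) (Hp : D.Q' →ₗ[ℝ] D.Q) : D.X' →ₗ[ℝ] D.X :=
  (Hw.coprod 0).prod (LinearMap.coprod 0 Hp)

/-- The block lower triangular preconditioner `[[Hw⁻¹, 0], [-B, Hp⁻¹]]⁻¹`. -/
def ML (Hw : D.W' →ₗ[ℝ] D.W) (Hp : D.Q' →ₗ[ℝ] D.Q) : D.X' →ₗ[ℝ] D.X :=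
  linInv (((linInv Hw).coprod 0).prod ((-D.B).coprod (linInv Hp)))

/-- The inner product `(x, y) = ⟨M⁻¹ x, y⟩` on `X`. -/
def ip (M : D.X' →ₗ[ℝ] D.X) (x y : D.X) : ℝ := D.pair (linInv M x) y

/-- The norm of the inner product `ip M`. -/
def ipNorm (M : D.X' →ₗ[ℝ] D.X) (x : D.X) : ℝ := Real.sqrt (D.ip M x x)

/-- The norm `‖w‖_A = ‖w‖_a`. -/
def normA (w : D.W) : ℝ := Real.sqrt (D.A w w)

/-- The norm `‖w‖_{D_A} = ‖w‖_{aᴰ}`. -/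
def normDA (w : D.W) : ℝ := Real.sqrt (D.DA w w)

end Problem

/-- `H : E' → E` is symmetric positive definite. -/
def IsSPD {E : Type*} [AddCommGroup E] [Module ℝ E] (H : Module.Dual ℝ E →ₗ[ℝ] E) : Prop :=
  (∀ f g : Module.Dual ℝ E, f (H g) = g (H f)) ∧ ∀ f : Module.Dual ℝ E, f ≠ 0 → 0 < f (H f)

/-- `c₁ (H f, f) ≤ (S f, f) ≤ c₂ (H f, f)` for all `f ∈ E'`. -/
def SpectrallyEquiv {E : Type*} [AddCommGroup E] [Module ℝ E]
    (c₁ c₂ : ℝ) (H S : Module.Dual ℝ E →ₗ[ℝ] E) : Prop :=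
  ∀ f : Module.Dual ℝ E, c₁ * f (H f) ≤ f (S f) ∧ f (S f) ≤ c₂ * f (H f)

end

end MixedDim

/-!
On one element the mass matrix of the `d + 1` Raviart–Thomas basis fields is a Gram matrix, so it is
at most `d + 1` times its diagonal.  Conversely, each coefficient is controlled by the field: up to
the height of the simplex it is an affine function of a barycentric coordinate, hence not small on
one of the copies of the element shrunk by `1 / 4` towards the vertices; the inscribed ball bounds
the height from below and the anisotropy bound compares `K⁻¹` with the Euclidean metric.  Adding the
elements and the common interface term shows that `a` and `aᴰ` are equivalent.

For the preconditioner put `G = H_w A` and `z = A⁻¹ Bᵀ p`.  Then `𝓜_L 𝓐 (w, p)` is the pair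
`(G (w + z), H_p B (G (w + z) - w))`, and the Schur complements of `A` and `D_A` being equivalent,
`⟨A z, z⟩` is comparable with `⟨H_p⁻¹ p, p⟩`.  Since `G` is self-adjoint and positive for
`⟨A ·, ·⟩`, both bounds become estimates for two positive semidefinite forms `⟨A ·, ·⟩` and
`⟨A G ·, ·⟩` in `w` and `z`; in the lower one `‖I - G‖_A ≤ ρ` gives the factor `(1 - ρ) / 2`.
-/

namespace MixedDim

open LinearMap (BilinForm)

/-! ### Positive semidefinite forms and their inverses -/

section Forms

variable {E : Type*} [AddCommGroup E] [Module ℝ E] {a b : BilinForm ℝ E}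

theorem sq_apply_le_apply_self_mul (ha : a.IsPosSemidef) (x y : E) :
    a x y ^ 2 ≤ a x x * a y y :=
  a.apply_sq_le_of_symm ha.nonneg ⟨ha.eq⟩ x y

theorem abs_apply_le_sqrt_mul_sqrt (ha : a.IsPosSemidef) (x y : E) :
    |a x y| ≤ √(a x x) * √(a y y) := by
  rw [← Real.sqrt_mul (ha.nonneg x)]
  exact Real.abs_le_sqrt (sq_apply_le_apply_self_mul ha x y)

theorem apply_le_mul_apply_self (ha : a.IsPosSemidef) {C : ℝ} (hC : 0 ≤ C) {x y : E}
    (h : a x x ≤ C * a x y) : a x y ≤ C * a y y := by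
  rcases le_or_gt (a x y) 0 with hxy | hxy
  · exact hxy.trans (mul_nonneg hC (ha.nonneg y))
  · refine le_of_mul_le_mul_right ?_ hxy
    calc a x y * a x y = a x y ^ 2 := (sq _).symm
      _ ≤ a x x * a y y := sq_apply_le_apply_self_mul ha x y
      _ ≤ C * a x y * a y y := mul_le_mul_of_nonneg_right h (ha.nonneg y)
      _ = C * a y y * a x y := by ring

/-- With `x = a⁻¹ f` and `y = b⁻¹ f`: if `b ≤ C a`, then `a⁻¹ ≤ C b⁻¹`. -/
theorem apply_self_le_of_apply_eq (hb : b.IsPosSemidef) {C : ℝ} (hC : 0 ≤ C) {x y : E}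
    (hxy : a x = b y) (h : b x x ≤ C * a x x) : a x x ≤ C * b y y := by
  have hxx : a x x = b x y := by rw [hxy, hb.eq]
  rw [hxx] at h ⊢
  exact apply_le_mul_apply_self hb hC h

theorem apply_sum_sum_le {ι : Type*} (ha : a.IsPosSemidef) (s : Finset ι) (u : ι → E) :
    a (∑ i ∈ s, u i) (∑ i ∈ s, u i) ≤ s.card * ∑ i ∈ s, a (u i) (u i) := by
  calc a (∑ i ∈ s, u i) (∑ i ∈ s, u i) = ∑ i ∈ s, ∑ j ∈ s, a (u i) (u j) := by
        rw [map_sum a, LinearMap.sum_apply]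
        simp only [map_sum]
    _ ≤ ∑ i ∈ s, ∑ j ∈ s, √(a (u i) (u i)) * √(a (u j) (u j)) :=
        Finset.sum_le_sum fun i _ => Finset.sum_le_sum fun j _ =>
          (le_abs_self _).trans (abs_apply_le_sqrt_mul_sqrt ha _ _)
    _ = (∑ i ∈ s, √(a (u i) (u i))) ^ 2 := by rw [sq, Finset.sum_mul_sum]
    _ ≤ s.card * ∑ i ∈ s, √(a (u i) (u i)) ^ 2 := sq_sum_le_card_mul_sum_sq
    _ = s.card * ∑ i ∈ s, a (u i) (u i) := by simp only [Real.sq_sqrt (ha.nonneg _)]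

theorem apply_self_pos_of_injective (ha : a.IsPosSemidef) (hinj : Function.Injective a) {x : E}
    (hx : x ≠ 0) : 0 < a x x := by
  refine (ha.nonneg x).lt_of_ne' fun h => hx ?_
  have hker := (a.apply_apply_same_eq_zero_iff ha.nonneg ⟨ha.eq⟩).1 h
  exact hinj (hker.trans (map_zero a).symm)

theorem bijective_of_apply_self_pos [FiniteDimensional ℝ E] {A : E →ₗ[ℝ] Module.Dual ℝ E}
    (hA : ∀ x, x ≠ 0 → 0 < A x x) : Function.Bijective A := by
  have hinj : Function.Injective A := by
    refine (injective_iff_map_eq_zero A).2 fun x hx => by_contra fun h0 => ?_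
    simpa [hx] using hA x h0
  exact ⟨hinj, (LinearMap.injective_iff_surjective_of_finrank_eq_finrank
    Subspace.dual_finrank_eq.symm).1 hinj⟩

end Forms

section Inverse

variable {E F : Type*} [AddCommGroup E] [Module ℝ E] [AddCommGroup F] [Module ℝ F]
  {L : E →ₗ[ℝ] F}

theorem linInv_apply_apply (hL : Function.Bijective L) (x : E) : linInv L (L x) = x := by
  rw [linInv, dif_pos hL]
  exact (LinearEquiv.ofBijective L hL).symm_apply_apply x

theorem apply_linInv_apply (hL : Function.Bijective L) (y : F) : L (linInv L y) = y := by
  rw [linInv, dif_pos hL]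
  exact (LinearEquiv.ofBijective L hL).apply_symm_apply y

theorem linInv_eq_of_inverse {M : F →ₗ[ℝ] E} (hML : Function.LeftInverse M L)
    (hLM : Function.RightInverse M L) : linInv L = M :=
  LinearMap.ext fun y => by
    rw [← linInv_apply_apply ⟨hML.injective, hLM.surjective⟩ (M y), hLM y]

theorem linInv_of_not_bijective (hL : ¬Function.Bijective L) : linInv L = 0 :=
  dif_neg hL

end Inverse

section SpectralEquivalence

variable {E : Type*} [AddCommGroup E] [Module ℝ E]
  {H : Module.Dual ℝ E →ₗ[ℝ] E} {S : E →ₗ[ℝ] Module.Dual ℝ E} {c C : ℝ}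

theorem SpectrallyEquiv.bijective (hc : 0 < c) (hH : IsSPD H)
    (h : SpectrallyEquiv c C H (linInv S)) : Function.Bijective S := by
  by_contra hS
  have hdual (f : Module.Dual ℝ E) : f = 0 := by
    by_contra hf
    have hle := (h f).1
    rw [linInv_of_not_bijective hS, LinearMap.zero_apply, map_zero] at hle
    exact (mul_pos hc (hH.2 f hf)).not_ge hle
  have hE (x : E) : x = 0 :=
    (Module.forall_dual_apply_eq_zero_iff ℝ x).1 fun f => by rw [hdual f, LinearMap.zero_apply]
  exact hS ⟨fun x y _ => (hE x).trans (hE y).symm, fun f => ⟨0, by rw [hdual f, map_zero]⟩⟩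

variable [FiniteDimensional ℝ E]

theorem IsSPD.bijective (hH : IsSPD H) : Function.Bijective H := by
  have hinj : Function.Injective H := by
    refine (injective_iff_map_eq_zero H).2 fun f hf => by_contra fun h0 => ?_
    simpa [hf] using hH.2 f h0
  exact ⟨hinj, (LinearMap.injective_iff_surjective_of_finrank_eq_finrank
    Subspace.dual_finrank_eq).1 hinj⟩

theorem IsSPD.linInv_apply_self_pos (hH : IsSPD H) {x : E} (hx : x ≠ 0) :
    0 < linInv H x x := by
  obtain ⟨f, rfl⟩ := hH.bijective.2 x
  rw [linInv_apply_apply hH.bijective]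
  exact hH.2 f fun hf => hx (by rw [hf, map_zero])

theorem IsSPD.isPosSemidef_linInv (hH : IsSPD H) : BilinForm.IsPosSemidef (linInv H) where
  eq x y := by
    obtain ⟨f, rfl⟩ := hH.bijective.2 x
    obtain ⟨g, rfl⟩ := hH.bijective.2 y
    simpa only [linInv_apply_apply hH.bijective] using hH.1 f g
  nonneg x := by
    rcases eq_or_ne x 0 with rfl | hx
    · rw [map_zero]
    · exact (hH.linInv_apply_self_pos hx).le

theorem SpectrallyEquiv.apply_self_le (hc : 0 < c) (hH : IsSPD H)
    (h : SpectrallyEquiv c C H (linInv S)) (x : E) : S x x ≤ c⁻¹ * linInv H x x := by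
  have hle := (h (S x)).1
  rw [linInv_apply_apply (h.bijective hc hH), ← le_inv_mul_iff₀ hc] at hle
  have hS : linInv H (H (S x)) = S x := linInv_apply_apply hH.bijective _
  have := apply_le_mul_apply_self hH.isPosSemidef_linInv (inv_nonneg.2 hc.le)
    (x := H (S x)) (y := x) (by rwa [hS])
  rwa [hS] at this

theorem SpectrallyEquiv.linInv_apply_self_le (hc : 0 < c) (hC : 0 ≤ C) (hH : IsSPD H)
    (hS : BilinForm.IsPosSemidef S) (h : SpectrallyEquiv c C H (linInv S)) (x : E) :
    linInv H x x ≤ C * S x x := by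
  obtain ⟨y, hy⟩ := (h.bijective hc hH).2 (linInv H x)
  have hle := (h (linInv H x)).2
  rw [← hy, linInv_apply_apply (h.bijective hc hH), hy, apply_linInv_apply hH.bijective,
    ← hy] at hle
  rw [← hy]
  exact apply_le_mul_apply_self hS hC hle

end SpectralEquivalence

/-! ### Saddle point operators -/

section SchurComplement

variable {E F : Type*} [AddCommGroup E] [Module ℝ E] [AddCommGroup F] [Module ℝ F]

/-- The (negative) Schur complement `B T⁻¹ Bᵀ` of the saddle point operator with blocks `T`, `Bᵀ`,
`B`; it generalizes `Problem.Schur`. -/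
noncomputable def schurComplement (T : E →ₗ[ℝ] Module.Dual ℝ E) (B : E →ₗ[ℝ] Module.Dual ℝ F) :
    F →ₗ[ℝ] Module.Dual ℝ F :=
  B ∘ₗ linInv T ∘ₗ B.flip

variable {A T : E →ₗ[ℝ] Module.Dual ℝ E} {B : E →ₗ[ℝ] Module.Dual ℝ F}

theorem schurComplement_apply (hT : Function.Bijective T) {p q : F} {s t : E}
    (hs : T s = B.flip p) (ht : T t = B.flip q) : schurComplement T B p q = T t s := by
  rw [schurComplement, LinearMap.comp_apply, LinearMap.comp_apply, ← hs, linInv_apply_apply hT,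
    ht, LinearMap.flip_apply]

theorem isPosSemidef_schurComplement (hT : BilinForm.IsPosSemidef T)
    (hTb : Function.Bijective T) : BilinForm.IsPosSemidef (schurComplement T B) where
  eq p q := by
    obtain ⟨s, hs⟩ := hTb.2 (B.flip p)
    obtain ⟨t, ht⟩ := hTb.2 (B.flip q)
    rw [schurComplement_apply hTb hs ht, schurComplement_apply hTb ht hs]
    exact hT.eq t s
  nonneg p := by
    obtain ⟨s, hs⟩ := hTb.2 (B.flip p)
    rw [schurComplement_apply hTb hs hs]
    exact hT.nonneg s

theorem apply_self_le_schurComplement (hT : BilinForm.IsPosSemidef T)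
    (hTb : Function.Bijective T) {C : ℝ} (hC : 0 ≤ C) (hTA : ∀ x, T x x ≤ C * A x x) {z : E}
    {p : F} (hz : A z = B.flip p) : A z z ≤ C * schurComplement T B p p := by
  obtain ⟨t, ht⟩ := hTb.2 (B.flip p)
  rw [schurComplement_apply hTb ht ht]
  exact apply_self_le_of_apply_eq hT hC (hz.trans ht.symm) (hTA z)

theorem schurComplement_le_apply_self (hA : BilinForm.IsPosSemidef A)
    (hTb : Function.Bijective T) {C : ℝ} (hC : 0 ≤ C) (hAT : ∀ x, A x x ≤ C * T x x) {z : E}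
    {p : F} (hz : A z = B.flip p) : schurComplement T B p p ≤ C * A z z := by
  obtain ⟨t, ht⟩ := hTb.2 (B.flip p)
  rw [schurComplement_apply hTb ht ht]
  exact apply_self_le_of_apply_eq hA hC (ht.trans hz.symm) (hAT t)

end SchurComplement

/-- Cauchy–Schwarz for the vectors `(x, x, ζ, √a ζ)` and `(y, t, y, √a t)`. -/
theorem sq_block_form_le {a : ℝ} (ha : 0 ≤ a) (x ζ y t : ℝ) :
    (x * y + ζ * y + x * t + a * (ζ * t)) ^ 2 ≤
      (2 * x ^ 2 + (1 + a) * ζ ^ 2) * (2 * y ^ 2 + (1 + a) * t ^ 2) := by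
  have hsum : 0 ≤ (x * y - ζ * y) ^ 2 + (x * t - x * y) ^ 2 + (ζ * t - x * y) ^ 2
      + a * ((x * t - ζ * y) ^ 2 + (ζ * t - ζ * y) ^ 2 + (x * t - ζ * t) ^ 2) := by positivity
  linarith

theorem le_sq_mul_of_sq_le_mul {ξ X Y U V : ℝ} (hX : 0 ≤ X) (hY : 0 ≤ Y) (hV : 0 ≤ V)
    (h : Y ^ 2 ≤ U * V) (hU : U ≤ ξ * X) (hVY : V ≤ ξ * Y) (hξ : 0 ≤ ξ) : Y ≤ ξ ^ 2 * X := by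
  rcases hY.eq_or_lt with rfl | hpos
  · positivity
  · refine le_of_mul_le_mul_right ?_ hpos
    calc Y * Y = Y ^ 2 := (sq Y).symm
      _ ≤ U * V := h
      _ ≤ ξ * X * (ξ * Y) := by gcongr
      _ = ξ ^ 2 * X * Y := by ring

section BlockTriangular

variable {E F : Type*} [AddCommGroup E] [Module ℝ E] [AddCommGroup F] [Module ℝ F]
  {A P : BilinForm ℝ E} {N : BilinForm ℝ F} {B : E →ₗ[ℝ] Module.Dual ℝ F} {G : E →ₗ[ℝ] E}

theorem isPosSemidef_compl₂ (hP : P.IsPosSemidef) (hPG : ∀ u, P (G u) = A u) :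
    BilinForm.IsPosSemidef (A.compl₂ G) where
  eq u v := by
    simp only [LinearMap.compl₂_apply, ← hPG]
    exact hP.eq _ _
  nonneg u := by
    simp only [LinearMap.compl₂_apply, ← hPG]
    exact hP.nonneg _

theorem apply_self_le_apply_comp (hP : P.IsPosSemidef) (hPG : ∀ u, P (G u) = A u) {c : ℝ}
    (hc : 0 ≤ c) (hPA : ∀ u, P u u ≤ c * A u u) (z : E) : A z z ≤ c * A z (G z) := by
  have h := apply_self_le_of_apply_eq (x := z) (y := G z) hP hc (hPG z).symm (hPA z)
  rwa [hPG] at h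

theorem apply_comp_le_apply_self (hA : A.IsPosSemidef) (hPG : ∀ u, P (G u) = A u) {c : ℝ}
    (hc : 0 ≤ c) (hAP : ∀ u, A u u ≤ c * P u u) (z : E) : A z (G z) ≤ c * A z z := by
  have h := apply_self_le_of_apply_eq (x := G z) (y := z) hA hc (hPG z) (hAP (G z))
  rwa [hPG] at h

/-- The field of values of the preconditioned operator in the flux variable `w` and in
`z = A⁻¹ Bᵀ p`, with `b = A Hw A`. -/
theorem half_mul_le_of_isPosSemidef {b : BilinForm ℝ E} (hb : b.IsPosSemidef) {ρ α : ℝ}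
    (hρ : 0 ≤ ρ) {w : E} (hw : b w w ≤ (1 + ρ) * α) (z : E) :
    (1 - ρ) / 2 * (α + b z z) ≤ α + b z w + b z z := by
  have hwz := hb.nonneg (w + z)
  have hzz := mul_nonneg hρ (hb.nonneg z)
  simp only [map_add, LinearMap.add_apply, hb.eq w z] at hwz
  linarith

theorem apply_comp_self_le (hA : A.IsPosSemidef) {ρ : ℝ} {w : E}
    (hG : √(A (w - G w) (w - G w)) ≤ ρ * √(A w w)) : A w (G w) ≤ (1 + ρ) * A w w := by
  have h := (abs_apply_le_sqrt_mul_sqrt hA w (w - G w)).trans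
    (mul_le_mul_of_nonneg_left hG (Real.sqrt_nonneg _))
  rw [mul_left_comm, Real.mul_self_sqrt (hA.nonneg w), map_sub] at h
  linarith [neg_le_of_abs_le h]

/-- The left hand side is a multiple of `‖(w, p)‖²` and the right hand side is the pairing of the
image of `(w, p)` with `(w, p)`, both in the inner product of the diagonal blocks `P` and `N`. -/
theorem le_apply_add_apply_sub (hA : A.IsPosSemidef) (hP : P.IsPosSemidef)
    (hN : N.IsPosSemidef) (hPG : ∀ u, P (G u) = A u) {ρ c C : ℝ} (hρ₀ : 0 ≤ ρ) (hρ₁ : ρ ≤ 1)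
    (hc : 0 < c) (hC : 0 < C) (hPA : ∀ u, P u u ≤ c * A u u)
    (hG : ∀ u, √(A (u - G u) (u - G u)) ≤ ρ * √(A u u)) {w z : E} {p : F}
    (hz : A z = B.flip p) (hNA : N p p ≤ C * A z z) :
    (1 - ρ) / 2 * min c⁻¹ (c⁻¹ * C⁻¹) * (P w w + N p p) ≤
      P (G (w + z)) w + B (G (w + z) - w) p := by
  have hpairing : P (G (w + z)) w + B (G (w + z) - w) p =
      A w w + A.compl₂ G z w + A.compl₂ G z z := by
    rw [hPG, ← B.flip_apply, ← hz]
    simp only [map_add, map_sub, LinearMap.add_apply, LinearMap.compl₂_apply]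
    ring
  have hw : c⁻¹ * P w w ≤ A w w := (inv_mul_le_iff₀ hc).2 (hPA w)
  have hp : c⁻¹ * C⁻¹ * N p p ≤ A z (G z) := by
    rw [mul_assoc, inv_mul_le_iff₀ hc, inv_mul_le_iff₀ hC]
    refine hNA.trans (mul_le_mul_of_nonneg_left ?_ hC.le)
    exact apply_self_le_apply_comp hP hPG hc.le hPA z
  calc (1 - ρ) / 2 * min c⁻¹ (c⁻¹ * C⁻¹) * (P w w + N p p)
      = (1 - ρ) / 2 * (min c⁻¹ (c⁻¹ * C⁻¹) * P w w + min c⁻¹ (c⁻¹ * C⁻¹) * N p p) := by ring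
    _ ≤ (1 - ρ) / 2 * (c⁻¹ * P w w + c⁻¹ * C⁻¹ * N p p) := by
        refine mul_le_mul_of_nonneg_left ?_ (by linarith)
        exact add_le_add (mul_le_mul_of_nonneg_right (min_le_left _ _) (hP.nonneg w))
          (mul_le_mul_of_nonneg_right (min_le_right _ _) (hN.nonneg p))
    _ ≤ (1 - ρ) / 2 * (A w w + A.compl₂ G z z) :=
        mul_le_mul_of_nonneg_left (add_le_add hw hp) (by linarith)
    _ ≤ A w w + A.compl₂ G z w + A.compl₂ G z z :=
        half_mul_le_of_isPosSemidef (isPosSemidef_compl₂ hP hPG) hρ₀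
          (apply_comp_self_le hA (hG w)) z
    _ = _ := hpairing.symm

theorem apply_add_sub_add_le (hA : A.IsPosSemidef) (hAG : BilinForm.IsPosSemidef (A.compl₂ G))
    {a : ℝ} (ha : 0 ≤ a) (hle : ∀ u, A u (G u) ≤ a * A u u)
    (hG : ∀ u, √(A (u - G u) (u - G u)) ≤ √(A u u)) (w z y t : E) :
    A (w + z) y - A (w - G w) t + A z (G t) ≤
      √(A w w) * √(A y y) + √(A z z) * √(A y y) + √(A w w) * √(A t t)
        + a * (√(A z z) * √(A t t)) := by
  have hwy := le_of_abs_le (abs_apply_le_sqrt_mul_sqrt hA w y)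
  have hzy := le_of_abs_le (abs_apply_le_sqrt_mul_sqrt hA z y)
  have hwt : -(A (w - G w) t) ≤ √(A w w) * √(A t t) :=
    (neg_le_of_neg_le (neg_le_of_abs_le (abs_apply_le_sqrt_mul_sqrt hA (w - G w) t))).trans
      (mul_le_mul_of_nonneg_right (hG w) (Real.sqrt_nonneg _))
  have hzt : A z (G t) ≤ a * (√(A z z) * √(A t t)) := by
    calc A z (G t) ≤ √(A z (G z)) * √(A t (G t)) :=
          le_of_abs_le (abs_apply_le_sqrt_mul_sqrt hAG z t)
      _ ≤ √(a * A z z) * √(a * A t t) := by gcongr <;> apply hle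
      _ = √a * √a * (√(A z z) * √(A t t)) := by
          rw [Real.sqrt_mul ha, Real.sqrt_mul ha]
          ring
      _ = a * (√(A z z) * √(A t t)) := by rw [Real.mul_self_sqrt ha]
  rw [map_add, LinearMap.add_apply]
  linarith

/-- Both sides are squared norms in the inner product of the diagonal blocks `P` and `N`: of the
image `(y, q)` of `(w, p)`, and of `(w, p)`. -/
theorem apply_self_add_apply_self_le (hA : A.IsPosSemidef) (hP : P.IsPosSemidef)
    (hN : N.IsPosSemidef) (hPG : ∀ u, P (G u) = A u) {a κ : ℝ} (ha : 0 ≤ a)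
    (hAP : ∀ u, A u u ≤ a * P u u) (hG : ∀ u, √(A (u - G u) (u - G u)) ≤ √(A u u))
    (hAN : ∀ z p, A z = B.flip p → A z z ≤ κ * N p p) {w z t : E} {p q : F}
    (hz : A z = B.flip p) (ht : A t = B.flip q) (hq : N q = B (G (w + z) - w)) :
    P (G (w + z)) (G (w + z)) + N q q ≤
      max (2 * a) (κ * (1 + a)) ^ 2 * (P w w + N p p) := by
  set y := G (w + z) with hy
  set ξ := max (2 * a) (κ * (1 + a))
  have hξ : 0 ≤ ξ := le_max_of_le_left (by positivity)
  have hAG := isPosSemidef_compl₂ hP hPG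
  have himage : P y y + N q q = A (w + z) y - A (w - G w) t + A z (G t) := by
    have hsymm : A z (G t) = A t (G z) := hAG.eq z t
    have hty : A t y = A t (G w) + A t (G z) := by rw [hy, map_add, map_add]
    rw [hPG, hq, ← B.flip_apply, ← ht, hA.eq _ t, hsymm, map_sub, map_sub, hty]
    ring
  have hweights (u : E) (r : F) {v : E} (hv : A v = B.flip r) :
      2 * √(A u u) ^ 2 + (1 + a) * √(A v v) ^ 2 ≤ ξ * (P u u + N r r) := by
    rw [Real.sq_sqrt (hA.nonneg u), Real.sq_sqrt (hA.nonneg v)]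
    calc 2 * A u u + (1 + a) * A v v ≤ 2 * (a * P u u) + (1 + a) * (κ * N r r) := by
          gcongr
          exacts [hAP u, hAN v r hv]
      _ = 2 * a * P u u + κ * (1 + a) * N r r := by ring
      _ ≤ ξ * P u u + ξ * N r r :=
          add_le_add (mul_le_mul_of_nonneg_right (le_max_left _ _) (hP.nonneg u))
            (mul_le_mul_of_nonneg_right (le_max_right _ _) (hN.nonneg r))
      _ = ξ * (P u u + N r r) := (mul_add _ _ _).symm
  have hnonneg (u : E) (r : F) : 0 ≤ P u u + N r r := add_nonneg (hP.nonneg u) (hN.nonneg r)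
  refine le_sq_mul_of_sq_le_mul (hnonneg w p) (hnonneg y q) (by positivity)
    (LE.le.trans ?_ (sq_block_form_le ha √(A w w) √(A z z) √(A y y) √(A t t)))
    (hweights w p hz) (hweights y q ht) hξ
  refine pow_le_pow_left₀ (hnonneg y q) (himage.trans_le ?_) 2
  exact apply_add_sub_add_le hA hAG ha (apply_comp_le_apply_self hA hPG ha hAP) hG w z y t

end BlockTriangular

/-! ### Raviart–Thomas fields on a simplex -/

theorem mem_affineSpan_image_iff_exists_weights {V ι : Type*} [AddCommGroup V] [Module ℝ V]
    [Fintype ι] (p : ι → V) (s : Set ι) (y : V) :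
    y ∈ affineSpan ℝ (p '' s) ↔
      ∃ w : ι → ℝ, ∑ i, w i = 1 ∧ (∀ i ∉ s, w i = 0) ∧ ∑ i, w i • p i = y := by
  classical
  constructor
  · intro hy
    obtain ⟨t, w, hts, hw, rfl⟩ := eq_affineCombination_of_mem_affineSpan_image hy
    refine ⟨fun i => if i ∈ t then w i else 0, by simpa using hw, fun i hi => ?_, ?_⟩
    · exact if_neg fun hit => hi (hts hit)
    · rw [Finset.affineCombination_eq_linear_combination _ _ _ hw]
      simp [ite_smul]
  · rintro ⟨w, hw, hws, rfl⟩
    rw [← Finset.affineCombination_eq_linear_combination _ _ _ hw]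
    exact affineCombination_mem_affineSpan_image hw (fun i _ hi => hws i hi) p

section Simplex

variable {n d : ℕ} (T : Simp n d)

theorem sum_smul_mem_closedInterior_iff {w : Fin (d + 1) → ℝ} (hw : ∑ l, w l = 1) :
    ∑ l, w l • T.points l ∈ T.closedInterior ↔ ∀ l, w l ∈ Set.Icc 0 1 := by
  rw [← Finset.affineCombination_eq_linear_combination _ _ _ hw,
    Affine.Simplex.affineCombination_mem_closedInterior_iff hw]

theorem exists_weights_of_mem_closedInterior {x : Pt n} (hx : x ∈ T.closedInterior) :
    ∃ w : Fin (d + 1) → ℝ, (∀ l, w l ∈ Set.Icc 0 1) ∧ ∑ l, w l = 1 ∧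
      ∑ l, w l • T.points l = x := by
  obtain ⟨w, hw, hmem, rfl⟩ := hx
  exact ⟨w, hmem, hw, (Finset.affineCombination_eq_linear_combination _ _ _ hw).symm⟩

theorem abs_mul_height_le_norm_sum_smul {c : Fin (d + 1) → ℝ} (hc : ∑ l, c l = 0)
    (k : Fin (d + 1)) : |c k| * height T k ≤ ‖∑ l, c l • T.points l‖ := by
  rcases eq_or_ne (c k) 0 with hck | hck
  · rw [hck, abs_zero, zero_mul]
    exact norm_nonneg _
  have hmem : T.points k - (c k)⁻¹ • ∑ l, c l • T.points l ∈
      affineSpan ℝ (T.points '' {k}ᶜ) := by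
    refine (mem_affineSpan_image_iff_exists_weights _ _ _).2
      ⟨fun l => (Pi.single k 1 : Fin (d + 1) → ℝ) l - (c k)⁻¹ * c l, ?_, fun l hl => ?_, ?_⟩
    · rw [Finset.sum_sub_distrib, Finset.sum_pi_single', ← Finset.mul_sum, hc]
      simp
    · obtain rfl : l = k := by simpa using hl
      simp only [Pi.single_eq_same, inv_mul_cancel₀ hck, sub_self]
    · simp [sub_smul, mul_smul, Finset.smul_sum, Pi.single_apply]
  rw [← le_inv_mul_iff₀ (abs_pos.2 hck)]
  calc height T k ≤ dist (T.points k) (T.points k - (c k)⁻¹ • ∑ l, c l • T.points l) :=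
        Metric.infDist_le_dist_of_mem hmem
    _ = |c k|⁻¹ * ‖∑ l, c l • T.points l‖ := by
        rw [dist_eq_norm, sub_sub_cancel, norm_smul, norm_inv, Real.norm_eq_abs]

section InscribedBall

variable {T} {c : Pt n} {r : ℝ}

theorem abs_mul_le_one_of_closedBall_subset (hc : c ∈ affineSpan ℝ (Set.range T.points))
    (hr : 0 ≤ r) (hball : Metric.closedBall c r ∩
      (affineSpan ℝ (Set.range T.points) : Set (Pt n)) ⊆ T.closedInterior)
    {a : Fin (d + 1) → ℝ} (ha : ∑ l, a l = 0) {t : ℝ}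
    (ht : |t| * ‖∑ l, a l • T.points l‖ ≤ r) (k : Fin (d + 1)) : |t * a k| ≤ 1 := by
  obtain ⟨u, hu, hu₁, hcu⟩ :=
    exists_weights_of_mem_closedInterior T (hball ⟨Metric.mem_closedBall_self hr, hc⟩)
  have hsum : ∑ l, (u l + t * a l) = 1 := by
    rw [Finset.sum_add_distrib, ← Finset.mul_sum, ha, hu₁, mul_zero, add_zero]
  have hpoint : ∑ l, (u l + t * a l) • T.points l = c + t • ∑ l, a l • T.points l := by
    simp only [add_smul, mul_smul, Finset.sum_add_distrib, hcu, Finset.smul_sum]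
  have hmem : ∑ l, (u l + t * a l) • T.points l ∈ T.closedInterior := by
    refine hball ⟨?_, ?_⟩
    · rwa [hpoint, Metric.mem_closedBall, dist_eq_norm, add_sub_cancel_left, norm_smul,
        Real.norm_eq_abs]
    · rw [← Finset.affineCombination_eq_linear_combination _ _ _ hsum]
      exact affineCombination_mem_affineSpan hsum _
  have hk := (sum_smul_mem_closedInterior_iff T hsum).1 hmem k
  rw [abs_le]
  constructor <;> linarith [hk.1, hk.2, (hu k).1, (hu k).2]

theorem mul_abs_le_norm_sum_smul_of_closedBall_subset
    (hc : c ∈ affineSpan ℝ (Set.range T.points)) (hr : 0 ≤ r)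
    (hball : Metric.closedBall c r ∩
      (affineSpan ℝ (Set.range T.points) : Set (Pt n)) ⊆ T.closedInterior)
    {a : Fin (d + 1) → ℝ} (ha : ∑ l, a l = 0) (k : Fin (d + 1)) :
    r * |a k| ≤ ‖∑ l, a l • T.points l‖ := by
  by_contra! hlt
  obtain ⟨s, hs, hsr⟩ := exists_between hlt
  have hs₀ : 0 < s := (norm_nonneg _).trans_lt hs
  have hle := abs_mul_le_one_of_closedBall_subset hc hr hball ha (t := r / s) (by
    rw [abs_of_nonneg (by positivity), div_mul_eq_mul_div, div_le_iff₀ hs₀]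
    exact mul_le_mul_of_nonneg_left hs.le hr) k
  rw [abs_mul, abs_of_nonneg (by positivity : 0 ≤ r / s), div_mul_eq_mul_div,
    div_le_one hs₀] at hle
  exact hsr.not_ge hle

theorem le_height_of_closedBall_subset (hd : 0 < d)
    (hc : c ∈ affineSpan ℝ (Set.range T.points)) (hr : 0 ≤ r)
    (hball : Metric.closedBall c r ∩
      (affineSpan ℝ (Set.range T.points) : Set (Pt n)) ⊆ T.closedInterior)
    (k : Fin (d + 1)) : r ≤ height T k := by
  have hne : (affineSpan ℝ (T.points '' {k}ᶜ) : Set (Pt n)).Nonempty := by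
    have : Nontrivial (Fin (d + 1)) := Fin.nontrivial_iff_two_le.2 (by omega)
    exact (affineSpan_nonempty ℝ).2 (Set.Nonempty.image _ (exists_ne k))
  refine (Metric.le_infDist hne).2 fun y hy => ?_
  obtain ⟨w, hw, hwk, rfl⟩ := (mem_affineSpan_image_iff_exists_weights _ _ _).1 hy
  have hle := mul_abs_le_norm_sum_smul_of_closedBall_subset hc hr hball
    (a := fun l => (Pi.single k 1 : Fin (d + 1) → ℝ) l - w l)
    (by rw [Finset.sum_sub_distrib, Finset.sum_pi_single', hw]; simp) k
  rw [dist_eq_norm]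
  simpa [hwk k (by simp), sub_smul, Pi.single_apply] using hle

end InscribedBall

section ShapeRegular

variable {T} {σ : ℝ}

theorem ShapeRegular.height_pos (hT : ShapeRegular σ T) (hd : 0 < d) (k : Fin (d + 1)) :
    0 < height T k := by
  obtain ⟨c, hc, r, hr, hball, -⟩ := hT
  exact hr.trans_le (le_height_of_closedBall_subset hd hc hr.le hball k)

theorem ShapeRegular.norm_rtBasis_le (hT : ShapeRegular σ T) (hd : 0 < d) (k : Fin (d + 1))
    {x : Pt n} (hx : x ∈ T.closedInterior) : ‖rtBasis T k x‖ ≤ σ := by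
  have hk := hT.height_pos hd k
  obtain ⟨c, hc, r, hr, hball, hdiam⟩ := hT
  have hσ : 0 ≤ σ := nonneg_of_mul_nonneg_left (Metric.diam_nonneg.trans hdiam) hr
  rw [rtBasis, norm_smul, norm_inv, Real.norm_of_nonneg hk.le, inv_mul_le_iff₀ hk, mul_comm]
  calc ‖x - T.points k‖ = dist x (T.points k) := (dist_eq_norm _ _).symm
    _ ≤ Metric.diam T.closedInterior :=
        Metric.dist_le_diam_of_mem (isCompact_closedInterior T).isBounded hx
          (T.point_mem_closedInterior k)
    _ ≤ σ * r := hdiam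
    _ ≤ σ * height T k :=
        mul_le_mul_of_nonneg_left (le_height_of_closedBall_subset hd hc hr.le hball k) hσ

end ShapeRegular

/-- The lowest-order Raviart–Thomas field on `T` with outer normal component `α k` on the face
opposite to the vertex `k`. -/
noncomputable def rtField (α : Fin (d + 1) → ℝ) (x : Pt n) : Pt n :=
  ∑ k, α k • rtBasis T k x

theorem continuous_rtBasis (k : Fin (d + 1)) : Continuous (rtBasis T k) := by
  unfold rtBasis
  fun_prop

theorem continuous_rtField (α : Fin (d + 1) → ℝ) : Continuous (rtField T α) :=
  continuous_finsetSum _ fun k _ => (continuous_rtBasis T k).const_smul (α k)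

theorem rtBasis_mem_vectorSpan (k : Fin (d + 1)) {x : Pt n} (hx : x ∈ T.closedInterior) :
    rtBasis T k x ∈ vectorSpan ℝ (Set.range T.points) := by
  refine Submodule.smul_mem _ _ ?_
  rw [← direction_affineSpan]
  exact AffineSubspace.vsub_mem_direction (T.closedInterior_subset_affineSpan hx)
    (subset_affineSpan ℝ _ (Set.mem_range_self k))

theorem rtField_mem_vectorSpan (α : Fin (d + 1) → ℝ) {x : Pt n} (hx : x ∈ T.closedInterior) :
    rtField T α x ∈ vectorSpan ℝ (Set.range T.points) :=
  Submodule.sum_mem _ fun k _ => Submodule.smul_mem _ _ (rtBasis_mem_vectorSpan T k hx)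

theorem rtField_sum_smul (α w : Fin (d + 1) → ℝ) :
    rtField T α (∑ l, w l • T.points l) =
      ∑ l, ((∑ j, α j * (height T j)⁻¹) * w l - α l * (height T l)⁻¹) • T.points l := by
  simp only [rtField, rtBasis, smul_smul, smul_sub, Finset.sum_sub_distrib, sub_smul]
  rw [← Finset.sum_smul, Finset.smul_sum]
  simp only [smul_smul]

theorem abs_mul_height_le_norm_rtField (α : Fin (d + 1) → ℝ) {w : Fin (d + 1) → ℝ}
    (hw : ∑ l, w l = 1) (k : Fin (d + 1)) :
    |(∑ j, α j * (height T j)⁻¹) * w k - α k * (height T k)⁻¹| * height T k ≤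
      ‖rtField T α (∑ l, w l • T.points l)‖ := by
  rw [rtField_sum_smul T α w]
  refine abs_mul_height_le_norm_sum_smul T
    (c := fun l => (∑ j, α j * (height T j)⁻¹) * w l - α l * (height T l)⁻¹) ?_ k
  rw [Finset.sum_sub_distrib, ← Finset.mul_sum, hw, mul_one, sub_self]

/-- The simplex `T`, contracted by the factor `1 / 4` towards the vertex `j`.  On it an affine
function of the barycentric coordinates is close to its value at the vertex. -/
def corner (j : Fin (d + 1)) : Set (Pt n) :=
  AffineMap.homothety (T.points j) (1 / 4 : ℝ) '' T.closedInterior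

theorem exists_weights_of_mem_corner (j : Fin (d + 1)) {x : Pt n} (hx : x ∈ corner T j) :
    ∃ w : Fin (d + 1) → ℝ, (∀ l, w l ∈ Set.Icc 0 1) ∧ ∑ l, w l = 1 ∧
      ∑ l, w l • T.points l = x ∧ 3 / 4 ≤ w j ∧ ∀ l, l ≠ j → w l ≤ 1 / 4 := by
  obtain ⟨y, hy, rfl⟩ := hx
  obtain ⟨u, hu, hu₁, rfl⟩ := exists_weights_of_mem_closedInterior T hy
  refine ⟨fun l => 1 / 4 * u l + (Pi.single j (3 / 4) : Fin (d + 1) → ℝ) l,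
    fun l => ?_, ?_, ?_, ?_, fun l hl => ?_⟩
  · have hl : (Pi.single j (3 / 4) : Fin (d + 1) → ℝ) l ∈ Set.Icc 0 (3 / 4) := by
      rw [Pi.single_apply]
      split_ifs <;> norm_num
    constructor <;> linarith [(hu l).1, (hu l).2, hl.1, hl.2]
  · rw [Finset.sum_add_distrib, ← Finset.mul_sum, hu₁, Finset.sum_pi_single',
      if_pos (Finset.mem_univ j)]
    norm_num
  · simp only [AffineMap.homothety_apply, vsub_eq_sub, vadd_eq_add, add_smul, mul_smul,
      Finset.sum_add_distrib, ← Finset.smul_sum, Pi.single_apply, ite_smul, zero_smul,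
      Finset.sum_ite_eq', Finset.mem_univ, if_true, smul_sub]
    module
  · simp only [Pi.single_eq_same]
    linarith [(hu j).1]
  · simp only [Pi.single_eq_of_ne hl]
    linarith [(hu l).2]

theorem corner_subset (j : Fin (d + 1)) : corner T j ⊆ T.closedInterior := by
  intro x hx
  obtain ⟨w, hw, hw₁, rfl, -⟩ := exists_weights_of_mem_corner T j hx
  exact (sum_smul_mem_closedInterior_iff T hw₁).2 hw

theorem measurableSet_corner (j : Fin (d + 1)) : MeasurableSet (corner T j) :=
  ((isCompact_closedInterior T).image (AffineMap.homothety_continuous _ _)).measurableSet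

theorem measureReal_corner (j : Fin (d + 1)) :
    (μHE[d] : Measure (Pt n)).real (corner T j) =
      (1 / 4) ^ d * (μHE[d] : Measure (Pt n)).real T.closedInterior := by
  rw [corner, measureReal_def, euclideanHausdorffMeasure_homothety_image d _ (by norm_num)]
  simp [measureReal_def, ENNReal.smul_def]

/-- If `s` is small compared with `β`, take a vertex where the `k`-th coordinate vanishes, and the
vertex `k` otherwise. -/
theorem exists_forall_half_abs_le {ι : Type*} [Nontrivial ι] (s β : ℝ) (k : ι) :
    ∃ j, ∀ w : ι → ℝ, 0 ≤ w k → 3 / 4 ≤ w j → (∀ l, l ≠ j → w l ≤ 1 / 4) →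
      |β| / 2 ≤ |s * w k - β| := by
  have habs (w : ι → ℝ) (hw : 0 ≤ w k) : |s * w k| = |s| * w k := by
    rw [abs_mul, abs_of_nonneg hw]
  by_cases hs : |s| ≤ 2 * |β|
  · obtain ⟨i, hi⟩ := exists_ne k
    refine ⟨i, fun w hw _ hle => ?_⟩
    have hsw : |s| * w k ≤ 2 * |β| * (1 / 4) := mul_le_mul hs (hle k hi.symm) hw (by positivity)
    have htri := abs_sub_abs_le_abs_sub β (s * w k)
    rw [abs_sub_comm, habs w hw] at htri
    linarith
  · refine ⟨k, fun w hw hge _ => ?_⟩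
    have hsw : 2 * |β| * (3 / 4) ≤ |s| * w k :=
      mul_le_mul (not_le.1 hs).le hge (by norm_num) (abs_nonneg s)
    have htri := abs_sub_abs_le_abs_sub (s * w k) β
    rw [habs w hw] at htri
    linarith

theorem exists_corner_half_abs_le_norm_rtField (hd : 0 < d) {k : Fin (d + 1)}
    (hk : 0 < height T k) (α : Fin (d + 1) → ℝ) :
    ∃ j, ∀ x ∈ corner T j, |α k| / 2 ≤ ‖rtField T α x‖ := by
  have : Nontrivial (Fin (d + 1)) := Fin.nontrivial_iff_two_le.2 (by omega)
  obtain ⟨j, hj⟩ :=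
    exists_forall_half_abs_le (∑ j, α j * (height T j)⁻¹) (α k * (height T k)⁻¹) k
  refine ⟨j, fun x hx => ?_⟩
  obtain ⟨w, hw, hw₁, rfl, hwj, hwl⟩ := exists_weights_of_mem_corner T j hx
  calc |α k| / 2 = |α k * (height T k)⁻¹| / 2 * height T k := by
        rw [abs_mul, abs_of_pos (inv_pos.2 hk)]
        field_simp
    _ ≤ _ := mul_le_mul_of_nonneg_right (hj w (hw k).1 hwj hwl) hk.le
    _ ≤ _ := abs_mul_height_le_norm_rtField T α hw₁ k

end Simplex

section Inner

variable {E : Type*} [NormedAddCommGroup E] [InnerProductSpace ℝ E] {L : E →ₗ[ℝ] E}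

theorem isPosSemidef_innerₗ_comp (hL : L.IsPositive) :
    LinearMap.BilinForm.IsPosSemidef (innerₗ E ∘ₗ L) where
  eq x y := (hL.isSymmetric x y).trans (real_inner_comm _ _)
  nonneg := hL.inner_nonneg_left

theorem inner_map_self_le_inv_mul {m : ℝ} (hm : 0 < m) {x : E}
    (h : m * ‖x‖ ^ 2 ≤ inner ℝ (L x) x) : inner ℝ (L x) x ≤ m⁻¹ * ‖L x‖ ^ 2 := by
  rw [← le_inv_mul_iff₀ hm] at h
  have hid : LinearMap.BilinForm.IsPosSemidef (innerₗ E) :=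
    isPosSemidef_innerₗ_comp LinearMap.isPositive_id
  have := apply_le_mul_apply_self hid (inv_nonneg.2 hm.le) (x := x) (y := L x)
  simp only [innerₗ_apply_apply, real_inner_self_eq_norm_sq, ← real_inner_comm x] at this
  exact this h

theorem norm_map_sq_le_mul_inner (hL : L.IsPositive) {M : ℝ} (hM : 0 ≤ M) {x : E}
    (h : inner ℝ (L (L x)) (L x) ≤ M * ‖L x‖ ^ 2) : ‖L x‖ ^ 2 ≤ M * inner ℝ (L x) x := by
  have hLx : inner ℝ (L (L x)) x = ‖L x‖ ^ 2 := by
    rw [hL.isSymmetric, real_inner_self_eq_norm_sq]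
  rw [← hLx] at h ⊢
  exact apply_le_mul_apply_self (isPosSemidef_innerₗ_comp hL) hM h

end Inner

section Energy

variable {n d : ℕ} (T : Simp n d) {L : Pt n →ₗ[ℝ] Pt n}

/-- The energy `(L φ, φ)_T` of the field `φ` on the simplex `T`.  With `L = K⁻¹` it is a diagonal
entry of the local mass matrix for a basis field, and a value of its quadratic form in general. -/
noncomputable def energy (L : Pt n →ₗ[ℝ] Pt n) (φ : Pt n → Pt n) : ℝ :=
  ∫ x in T.closedInterior, inner ℝ (L (φ x)) (φ x) ∂(μHE[d])

theorem integrableOn_inner_map {φ : Pt n → Pt n} (hφ : Continuous φ) :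
    IntegrableOn (fun x => inner ℝ (L (φ x)) (φ x)) T.closedInterior
      (μHE[d] : Measure (Pt n)) :=
  integrableOn_of_continuous T
    (((LinearMap.continuous_of_finiteDimensional L).comp hφ).inner hφ)

theorem energy_nonneg (hL : L.IsPositive) (φ : Pt n → Pt n) : 0 ≤ energy T L φ :=
  integral_nonneg fun _ => hL.inner_nonneg_left _

theorem energy_le_mul_measureReal {φ : Pt n → Pt n} (hφ : Continuous φ) {C : ℝ}
    (hC : ∀ x ∈ T.closedInterior, inner ℝ (L (φ x)) (φ x) ≤ C) :
    energy T L φ ≤ C * (μHE[d] : Measure (Pt n)).real T.closedInterior := by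
  calc energy T L φ ≤ ∫ _ in T.closedInterior, C ∂(μHE[d] : Measure (Pt n)) :=
        setIntegral_mono_on (integrableOn_inner_map T hφ)
          (integrableOn_const (measure_closedInterior_lt_top T).ne)
          (isCompact_closedInterior T).measurableSet hC
    _ = C * (μHE[d] : Measure (Pt n)).real T.closedInterior := by
        rw [setIntegral_const, smul_eq_mul, mul_comm]

theorem mul_measureReal_le_energy (hL : L.IsPositive) {φ : Pt n → Pt n} (hφ : Continuous φ)
    {s : Set (Pt n)} (hs : MeasurableSet s) (hsT : s ⊆ T.closedInterior) {C : ℝ}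
    (hC : ∀ x ∈ s, C ≤ inner ℝ (L (φ x)) (φ x)) :
    C * (μHE[d] : Measure (Pt n)).real s ≤ energy T L φ := by
  have hint := integrableOn_inner_map (L := L) T hφ
  have hfin : (μHE[d] : Measure (Pt n)) s ≠ ⊤ :=
    ((measure_mono hsT).trans_lt (measure_closedInterior_lt_top T)).ne
  calc C * (μHE[d] : Measure (Pt n)).real s
      ≤ ∫ x in s, inner ℝ (L (φ x)) (φ x) ∂(μHE[d]) :=
        setIntegral_ge_of_const_le_real hs hfin hC (hint.mono_set hsT)
    _ ≤ energy T L φ :=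
        setIntegral_mono_set hint (.of_forall fun _ => hL.inner_nonneg_left _) hsT.eventuallyLE

theorem energy_rtField_le (hL : L.IsPositive) (α : Fin (d + 1) → ℝ) :
    energy T L (rtField T α) ≤ (d + 1) * ∑ k, α k ^ 2 * energy T L (rtBasis T k) := by
  have hint (k : Fin (d + 1)) : IntegrableOn
      (fun x => α k ^ 2 * inner ℝ (L (rtBasis T k x)) (rtBasis T k x)) T.closedInterior
      (μHE[d] : Measure (Pt n)) :=
    (integrableOn_inner_map T (continuous_rtBasis T k)).const_mul _
  have hpoint (x : Pt n) : inner ℝ (L (rtField T α x)) (rtField T α x) ≤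
      (d + 1) * ∑ k, α k ^ 2 * inner ℝ (L (rtBasis T k x)) (rtBasis T k x) := by
    have h := apply_sum_sum_le (isPosSemidef_innerₗ_comp hL) Finset.univ
      fun k => α k • rtBasis T k x
    simpa only [rtField, LinearMap.comp_apply, map_smul, LinearMap.smul_apply, smul_eq_mul,
      innerₗ_apply_apply, real_inner_smul_right, Finset.card_univ, Fintype.card_fin,
      Nat.cast_add, Nat.cast_one, ← mul_assoc, ← sq] using h
  calc energy T L (rtField T α)
      ≤ ∫ x in T.closedInterior, (d + 1) *
          ∑ k, α k ^ 2 * inner ℝ (L (rtBasis T k x)) (rtBasis T k x) ∂(μHE[d]) :=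
        integral_mono (integrableOn_inner_map T (continuous_rtField T α))
          ((integrable_finsetSum _ fun k _ => hint k).const_mul _) hpoint
    _ = (d + 1) * ∑ k, α k ^ 2 * energy T L (rtBasis T k) := by
        rw [integral_const_mul, integral_finsetSum _ fun k _ => hint k]
        simp only [integral_const_mul, energy]

theorem energy_rtBasis_le {σ M : ℝ} (hT : ShapeRegular σ T) (hd : 0 < d) (hM : 0 ≤ M)
    (hLM : ∀ y ∈ vectorSpan ℝ (Set.range T.points), inner ℝ (L y) y ≤ M * ‖y‖ ^ 2)
    (k : Fin (d + 1)) : energy T L (rtBasis T k) ≤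
      M * σ ^ 2 * (μHE[d] : Measure (Pt n)).real T.closedInterior := by
  refine energy_le_mul_measureReal T (continuous_rtBasis T k) fun x hx => ?_
  refine (hLM _ (rtBasis_mem_vectorSpan T k hx)).trans (mul_le_mul_of_nonneg_left ?_ hM)
  exact pow_le_pow_left₀ (norm_nonneg _) (hT.norm_rtBasis_le hd k hx) 2

theorem sq_mul_measureReal_le_energy_rtField (hL : L.IsPositive) {m : ℝ} (hm : 0 ≤ m)
    (hmL : ∀ y ∈ vectorSpan ℝ (Set.range T.points), m * ‖y‖ ^ 2 ≤ inner ℝ (L y) y)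
    (hd : 0 < d) {k : Fin (d + 1)} (hk : 0 < height T k) (α : Fin (d + 1) → ℝ) :
    m * α k ^ 2 * (μHE[d] : Measure (Pt n)).real T.closedInterior ≤
      4 ^ (d + 1) * energy T L (rtField T α) := by
  obtain ⟨j, hj⟩ := exists_corner_half_abs_le_norm_rtField T hd hk α
  have hcorner : m * (|α k| / 2) ^ 2 * (μHE[d] : Measure (Pt n)).real (corner T j) ≤
      energy T L (rtField T α) := by
    refine mul_measureReal_le_energy T hL (continuous_rtField T α) (measurableSet_corner T j)
      (corner_subset T j) fun x hx => ?_
    refine le_trans ?_ (hmL _ (rtField_mem_vectorSpan T α (corner_subset T j hx)))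
    exact mul_le_mul_of_nonneg_left (pow_le_pow_left₀ (by positivity) (hj x hx) 2) hm
  rw [measureReal_corner, div_pow, sq_abs, one_div, inv_pow] at hcorner
  calc m * α k ^ 2 * (μHE[d] : Measure (Pt n)).real T.closedInterior
      = 4 ^ (d + 1) * (m * (α k ^ 2 / 2 ^ 2) *
          ((4 ^ d)⁻¹ * (μHE[d] : Measure (Pt n)).real T.closedInterior)) := by
        field_simp
        ring
    _ ≤ 4 ^ (d + 1) * energy T L (rtField T α) :=
        mul_le_mul_of_nonneg_left hcorner (by positivity)

theorem sum_sq_mul_energy_rtBasis_le (hL : L.IsPositive) {σ m M : ℝ} (hT : ShapeRegular σ T)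
    (hm : 0 < m) (hM : 0 ≤ M)
    (hmL : ∀ y ∈ vectorSpan ℝ (Set.range T.points), m * ‖y‖ ^ 2 ≤ inner ℝ (L y) y)
    (hLM : ∀ y ∈ vectorSpan ℝ (Set.range T.points), inner ℝ (L y) y ≤ M * ‖y‖ ^ 2)
    (hd : 0 < d) (α : Fin (d + 1) → ℝ) :
    ∑ k, α k ^ 2 * energy T L (rtBasis T k) ≤
      (d + 1) * (4 ^ (d + 1) * σ ^ 2 * (M / m)) * energy T L (rtField T α) := by
  have hterm (k : Fin (d + 1)) : α k ^ 2 * energy T L (rtBasis T k) ≤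
      4 ^ (d + 1) * σ ^ 2 * (M / m) * energy T L (rtField T α) := by
    calc α k ^ 2 * energy T L (rtBasis T k)
        ≤ α k ^ 2 * (M * σ ^ 2 * (μHE[d] : Measure (Pt n)).real T.closedInterior) :=
          mul_le_mul_of_nonneg_left (energy_rtBasis_le T hT hd hM hLM k) (sq_nonneg _)
      _ = σ ^ 2 * (M / m) *
            (m * α k ^ 2 * (μHE[d] : Measure (Pt n)).real T.closedInterior) := by
          field_simp
      _ ≤ σ ^ 2 * (M / m) * (4 ^ (d + 1) * energy T L (rtField T α)) :=
          mul_le_mul_of_nonneg_left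
            (sq_mul_measureReal_le_energy_rtField T hL hm.le hmL hd (hT.height_pos hd k) α)
            (by positivity)
      _ = 4 ^ (d + 1) * σ ^ 2 * (M / m) * energy T L (rtField T α) := by ring
  refine (Finset.sum_le_card_nsmul _ _ _ fun k _ => hterm k).trans_eq ?_
  rw [Finset.card_univ, Fintype.card_fin, nsmul_eq_mul, Nat.cast_add, Nat.cast_one]
  ring

end Energy

/-! ### The consistent and the lumped flux norm -/

theorem Params.AnisotropyLE.one_le {n : ℕ} {G : Geometry n} {P : Params G} {κ : ℝ}
    (h : P.AnisotropyLE κ) {i : G.I} (hi : 0 < G.dim i) : 1 ≤ κ := by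
  obtain ⟨m, hm, hK⟩ := h i
  rw [← G.Ω_dim] at hi
  have := Module.finrank_pos_iff.1 hi
  obtain ⟨x, hx⟩ := exists_ne (0 : vectorSpan ℝ (G.Ω i))
  have hpos : 0 < m * ‖(x : Pt n)‖ ^ 2 :=
    mul_pos hm (pow_pos (norm_pos_iff.2 fun h => hx (Subtype.ext h)) 2)
  have hle := (hK x x.2).1.trans (hK x x.2).2
  rw [mul_assoc] at hle
  exact (le_mul_iff_one_le_left hpos).1 hle

namespace Problem

variable {n : ℕ} (D : Problem n)

theorem K_injective (i : D.G.I) : Function.Injective (D.P.K i) := by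
  refine (injective_iff_map_eq_zero _).2 fun x hx => by_contra fun h => ?_
  simpa only [hx, inner_zero_left, lt_self_iff_false] using D.P.K_pos i x h

theorem K_bijective (i : D.G.I) : Function.Bijective (D.P.K i) :=
  ⟨D.K_injective i, LinearMap.surjective_of_injective (D.K_injective i)⟩

theorem isPositive_K (i : D.G.I) : (D.P.K i).IsPositive := by
  refine ⟨D.P.K_symm i, fun x => ?_⟩
  rcases eq_or_ne x 0 with rfl | hx
  · rw [map_zero, inner_zero_left, map_zero]
  · exact (D.P.K_pos i x hx).le

theorem isPositive_Kinv (i : D.G.I) : (D.Kinv i).IsPositive := by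
  refine ⟨D.Kinv_symm i, fun y => ?_⟩
  obtain ⟨x, rfl⟩ := (D.K_bijective i).2 y
  rw [Kinv, linInv_apply_apply (D.K_bijective i)]
  exact (D.isPositive_K i).inner_nonneg_right x

theorem Kinv_mem_vectorSpan (i : D.G.I) {y : Pt n} (hy : y ∈ vectorSpan ℝ (D.G.Ω i)) :
    D.Kinv i y ∈ vectorSpan ℝ (D.G.Ω i) := by
  have hinj : Function.Injective ((D.P.K i).restrict (D.P.K_tangential i)) := fun u v h =>
    Subtype.ext (D.K_injective i (congrArg Subtype.val h))
  obtain ⟨x, hx⟩ := LinearMap.surjective_of_injective hinj ⟨y, hy⟩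
  obtain rfl : D.P.K i x = y := congrArg Subtype.val hx
  rw [Kinv, linInv_apply_apply (D.K_bijective i)]
  exact x.2

theorem inner_Kinv_bounds {i : D.G.I} {m M : ℝ} (hm : 0 < m) (hM : 0 < M)
    (hK : ∀ x ∈ vectorSpan ℝ (D.G.Ω i),
      m * ‖x‖ ^ 2 ≤ inner ℝ (D.P.K i x) x ∧ inner ℝ (D.P.K i x) x ≤ M * ‖x‖ ^ 2)
    {y : Pt n} (hy : y ∈ vectorSpan ℝ (D.G.Ω i)) :
    M⁻¹ * ‖y‖ ^ 2 ≤ inner ℝ (D.Kinv i y) y ∧ inner ℝ (D.Kinv i y) y ≤ m⁻¹ * ‖y‖ ^ 2 := by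
  have hx := D.Kinv_mem_vectorSpan i hy
  have hKx : D.P.K i (D.Kinv i y) = y := apply_linInv_apply (D.K_bijective i) y
  have hlower := norm_map_sq_le_mul_inner (D.isPositive_K i) hM.le
    (hK _ (D.P.K_tangential i _ hx)).2
  have hupper := inner_map_self_le_inv_mul hm (hK _ hx).1
  rw [hKx, real_inner_comm] at hlower hupper
  exact ⟨(inv_mul_le_iff₀ hM).2 hlower, hupper⟩

theorem vectorSpan_le (e : D.𝓣.E) :
    vectorSpan ℝ (Set.range (D.𝓣.T e).points) ≤ vectorSpan ℝ (D.G.Ω (D.𝓣.sub e)) := by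
  have hclosure : closure (D.G.Ω (D.𝓣.sub e)) ⊆ affineSpan ℝ (D.G.Ω (D.𝓣.sub e)) :=
    closure_minimal (subset_affineSpan ℝ _) (AffineSubspace.closed_of_finiteDimensional _)
  rw [← direction_affineSpan, ← direction_affineSpan ℝ (D.G.Ω _)]
  refine AffineSubspace.direction_le (affineSpan_le.2 ?_)
  rintro _ ⟨k, rfl⟩
  refine hclosure ?_
  rw [D.𝓣.T_cover]
  exact Set.mem_iUnion₂_of_mem rfl ((D.𝓣.T e).point_mem_closedInterior k)

theorem tot_eq_zero_of_dim_eq_zero (w : D.W) {f : D.𝓣.Face}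
    (hf : D.G.dim (D.𝓣.sub f.1) = 0) : D.tot w f = 0 :=
  (add_mem w.1.2.1 (D.R w.2).2 : D.tot w ∈ D.𝓣.V).1 f hf

theorem cForm_self_nonneg (l : D.𝓣.Λ) : 0 ≤ D.cForm l l := by
  refine Finset.sum_nonneg fun m _ => integral_nonneg fun _ => ?_
  have hγ := D.P.γ_pos (D.𝓣.ifc m)
  have hKν := D.P.Kν_pos (D.𝓣.ifc m)
  simp only [Pi.zero_apply, mul_assoc _ (l m)]
  exact mul_nonneg (by positivity) (mul_self_nonneg _)

theorem A_apply_self (w : D.W) :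
    D.A w w = ∑ e, energy (D.𝓣.T e) (D.Kinv (D.𝓣.sub e))
      (rtField (D.𝓣.T e) fun k => D.tot w ⟨e, k⟩) + D.cForm w.2 w.2 :=
  rfl

theorem DA_apply_self (w : D.W) :
    D.DA w w = ∑ e, ∑ k, D.tot w ⟨e, k⟩ ^ 2 *
      energy (D.𝓣.T e) (D.Kinv (D.𝓣.sub e)) (rtBasis (D.𝓣.T e) k) + D.cForm w.2 w.2 := by
  simp only [sq]
  rfl

theorem isPosSemidef_A : LinearMap.BilinForm.IsPosSemidef D.A where
  eq := D.aForm_comm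
  nonneg w := by
    rw [A_apply_self]
    exact add_nonneg (Finset.sum_nonneg fun _ _ => energy_nonneg _ (D.isPositive_Kinv _) _)
      (D.cForm_self_nonneg _)

theorem isPosSemidef_DA : LinearMap.BilinForm.IsPosSemidef D.DA where
  eq := D.aDForm_comm
  nonneg w := by
    rw [DA_apply_self]
    exact add_nonneg
      (Finset.sum_nonneg fun _ _ => Finset.sum_nonneg fun _ _ =>
        mul_nonneg (sq_nonneg _) (energy_nonneg _ (D.isPositive_Kinv _) _))
      (D.cForm_self_nonneg _)

theorem A_apply_self_le (w : D.W) : D.A w w ≤ (n + 1) * D.DA w w := by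
  rw [A_apply_self, DA_apply_self, mul_add, Finset.mul_sum]
  refine add_le_add (Finset.sum_le_sum fun e _ => ?_)
    (le_mul_of_one_le_left (D.cForm_self_nonneg _) (by simp))
  refine (energy_rtField_le _ (D.isPositive_Kinv _) _).trans
    (mul_le_mul_of_nonneg_right ?_ (Finset.sum_nonneg fun _ _ =>
      mul_nonneg (sq_nonneg _) (energy_nonneg _ (D.isPositive_Kinv _) _)))
  exact_mod_cast Nat.succ_le_succ (D.G.dim_le _)

/-- The constant of the bound `⟨D_A w, w⟩ ≤ C ⟨A w, w⟩`, for elements of shape regularity `σ` and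
anisotropy `κ` of the permeability.  The value is at least `1` on account of the interface term,
which the two forms share. -/
noncomputable def lumpingConst (n : ℕ) (σ κ : ℝ) : ℝ :=
  max 1 ((n + 1) * (4 ^ (n + 1) * σ ^ 2 * κ))

theorem one_le_lumpingConst (n : ℕ) (σ κ : ℝ) : 1 ≤ lumpingConst n σ κ :=
  le_max_left _ _

theorem sum_sq_mul_energy_le_lumpingConst_mul {σ κ : ℝ} {e : D.𝓣.E}
    (hσ : ShapeRegular σ (D.𝓣.T e)) (hκ : D.P.AnisotropyLE κ) (w : D.W) :
    ∑ k, D.tot w ⟨e, k⟩ ^ 2 * energy (D.𝓣.T e) (D.Kinv (D.𝓣.sub e)) (rtBasis (D.𝓣.T e) k) ≤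
      lumpingConst n σ κ * energy (D.𝓣.T e) (D.Kinv (D.𝓣.sub e))
        (rtField (D.𝓣.T e) fun k => D.tot w ⟨e, k⟩) := by
  have hpos := D.isPositive_Kinv (D.𝓣.sub e)
  have henergy := energy_nonneg (D.𝓣.T e) hpos (rtField (D.𝓣.T e) fun k => D.tot w ⟨e, k⟩)
  rcases Nat.eq_zero_or_pos (D.G.dim (D.𝓣.sub e)) with hd | hd
  · have htot (k) : D.tot w ⟨e, k⟩ = 0 := D.tot_eq_zero_of_dim_eq_zero w hd
    refine le_of_eq_of_le (Finset.sum_eq_zero fun k _ => ?_)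
      (mul_nonneg (zero_le_one.trans (one_le_lumpingConst n σ κ)) henergy)
    rw [htot, zero_pow two_ne_zero, zero_mul]
  obtain ⟨m, hm, hK⟩ := hκ (D.𝓣.sub e)
  have hκ₀ : 0 < κ := zero_lt_one.trans_le (hκ.one_le hd)
  have hKinv {y : Pt n} (hy : y ∈ vectorSpan ℝ (Set.range (D.𝓣.T e).points)) :=
    D.inner_Kinv_bounds hm (mul_pos hκ₀ hm) hK (D.vectorSpan_le e hy)
  refine (sum_sq_mul_energy_rtBasis_le _ hpos hσ (inv_pos.2 (mul_pos hκ₀ hm)) (inv_pos.2 hm).le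
    (fun y hy => (hKinv hy).1) (fun y hy => (hKinv hy).2) hd _).trans
    (mul_le_mul_of_nonneg_right ?_ henergy)
  have hratio : m⁻¹ / (κ * m)⁻¹ = κ := by field_simp
  have hdim := D.G.dim_le (D.𝓣.sub e)
  rw [hratio]
  refine le_max_of_le_right ?_
  gcongr
  norm_num

theorem DA_apply_self_le {σ κ : ℝ} (hσ : ∀ e, ShapeRegular σ (D.𝓣.T e))
    (hκ : D.P.AnisotropyLE κ) (w : D.W) : D.DA w w ≤ lumpingConst n σ κ * D.A w w := by
  rw [A_apply_self, DA_apply_self, mul_add, Finset.mul_sum]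
  exact add_le_add
    (Finset.sum_le_sum fun e _ => D.sum_sq_mul_energy_le_lumpingConst_mul (hσ e) hκ w)
    (le_mul_of_one_le_left (D.cForm_self_nonneg _) (one_le_lumpingConst n σ κ))

theorem normA_le (w : D.W) : D.normA w ≤ √(n + 1) * D.normDA w := by
  rw [normDA, ← Real.sqrt_mul (by positivity)]
  exact Real.sqrt_le_sqrt (D.A_apply_self_le w)

theorem normDA_le {σ κ : ℝ} (hσ : ∀ e, ShapeRegular σ (D.𝓣.T e))
    (hκ : D.P.AnisotropyLE κ) (w : D.W) : D.normDA w ≤ √(lumpingConst n σ κ) * D.normA w := by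
  rw [normA, ← Real.sqrt_mul (zero_le_one.trans (one_le_lumpingConst n σ κ))]
  exact Real.sqrt_le_sqrt (D.DA_apply_self_le hσ hκ w)

theorem normA_sq (w : D.W) : D.normA w ^ 2 = D.A w w :=
  Real.sq_sqrt (D.isPosSemidef_A.nonneg w)

theorem normDA_sq (w : D.W) : D.normDA w ^ 2 = D.DA w w :=
  Real.sq_sqrt (D.isPosSemidef_DA.nonneg w)

theorem DA_bijective (hA : Function.Bijective D.A) : Function.Bijective D.DA := by
  refine bijective_of_apply_self_pos fun w hw => ?_
  refine pos_of_mul_pos_right ?_ (n.cast_add_one_pos (α := ℝ)).le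
  exact (apply_self_pos_of_injective D.isPosSemidef_A hA.1 hw).trans_le (D.A_apply_self_le w)

/-! ### The block triangular preconditioner -/

variable {Hw : D.W' →ₗ[ℝ] D.W} {Hp : D.Q' →ₗ[ℝ] D.Q}

theorem ip_MD (hw : Function.Bijective Hw) (hp : Function.Bijective Hp) (x y : D.X) :
    D.ip (D.MD Hw Hp) x y = linInv Hw x.1 y.1 + linInv Hp x.2 y.2 := by
  have hinv : linInv (D.MD Hw Hp) = (linInv Hw).prodMap (linInv Hp) := by
    refine linInv_eq_of_inverse (fun f => ?_) (fun x => ?_) <;>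
      simp [MD, linInv_apply_apply hw, linInv_apply_apply hp, apply_linInv_apply hw,
        apply_linInv_apply hp]
  rw [ip, hinv]
  rfl

theorem ML_apply (hw : Function.Bijective Hw) (hp : Function.Bijective Hp) (f : D.X') :
    D.ML Hw Hp f = (Hw f.1, Hp (f.2 + D.B (Hw f.1))) := by
  have hinv : D.ML Hw Hp = (Hw ∘ₗ LinearMap.fst ℝ _ _).prod
      (Hp ∘ₗ (LinearMap.snd ℝ _ _ + D.B ∘ₗ Hw ∘ₗ LinearMap.fst ℝ _ _)) := by
    refine linInv_eq_of_inverse (fun x => ?_) (fun f => ?_) <;>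
      simp [linInv_apply_apply hw, linInv_apply_apply hp, apply_linInv_apply hw,
        apply_linInv_apply hp]
  rw [hinv]
  rfl

theorem ML_calA (hw : Function.Bijective Hw) (hp : Function.Bijective Hp)
    {w z : D.W} {p : D.Q} (hz : D.A z = D.B.flip p) :
    D.ML Hw Hp (D.calA (w, p)) = (Hw (D.A (w + z)), Hp (D.B (Hw (D.A (w + z)) - w))) := by
  have hcalA : D.calA (w, p) = (D.A (w + z), -D.B w) := by
    rw [map_add, hz]
    simp [calA, BT]
  rw [D.ML_apply hw hp, hcalA, map_sub, neg_add_eq_sub]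

theorem ip_MD_self_pos (hw : IsSPD Hw) (hp : IsSPD Hp) {x : D.X} (hx : x ≠ 0) :
    0 < D.ip (D.MD Hw Hp) x x := by
  rw [D.ip_MD hw.bijective hp.bijective]
  by_cases hx₁ : x.1 = 0
  · have hx₂ : x.2 ≠ 0 := fun h => hx (Prod.ext hx₁ h)
    exact add_pos_of_nonneg_of_pos (hw.isPosSemidef_linInv.nonneg _) (hp.linInv_apply_self_pos hx₂)
  · exact add_pos_of_pos_of_nonneg (hw.linInv_apply_self_pos hx₁) (hp.isPosSemidef_linInv.nonneg _)

variable {c₁w c₂w c₁p c₂p ρ : ℝ}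

theorem le_ip_ML_calA_div {c₂ : ℝ} (hc₂ : 0 < c₂) (hAD : ∀ r, D.normA r ≤ c₂ * D.normDA r)
    (hc₁w : 0 < c₁w) (hc₂w : 0 < c₂w) (hc₁p : 0 < c₁p) (hc₂p : 0 < c₂p) (hρ₀ : 0 ≤ ρ) (hρ₁ : ρ ≤ 1)
    (hHw : IsSPD Hw) (hHp : IsSPD Hp)
    (hw : SpectrallyEquiv c₁w c₂w Hw (linInv D.A))
    (hp : SpectrallyEquiv c₁p c₂p Hp (linInv D.Schur))
    (hG : ∀ w, D.normA (w - Hw (D.A w)) ≤ ρ * D.normA w) {x : D.X} (hx : x ≠ 0) :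
    (1 - ρ) / 2 * min c₂w⁻¹ (c₂w⁻¹ * (c₂ ^ 2)⁻¹ * c₂p⁻¹) ≤
      D.ip (D.MD Hw Hp) (D.ML Hw Hp (D.calA x)) x / D.ip (D.MD Hw Hp) x x := by
  obtain ⟨w, p⟩ := x
  have hAb := hw.bijective hc₁w hHw
  have hDb := D.DA_bijective hAb
  obtain ⟨z, hz⟩ := hAb.2 (D.B.flip p)
  have hAD_sq (r : D.W) : D.A r r ≤ c₂ ^ 2 * D.DA r r := by
    rw [← normA_sq, ← normDA_sq, ← mul_pow]
    exact pow_le_pow_left₀ (Real.sqrt_nonneg _) (hAD r) 2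
  have hNA : linInv Hp p p ≤ c₂ ^ 2 * c₂p * D.A z z := by
    have hS := isPosSemidef_schurComplement (B := D.B) D.isPosSemidef_DA hDb
    have hNS := hp.linInv_apply_self_le hc₁p hc₂p.le hHp hS p
    have hSA := schurComplement_le_apply_self D.isPosSemidef_A hDb (sq_nonneg c₂) hAD_sq hz
    rw [mul_comm (c₂ ^ 2), mul_assoc]
    exact hNS.trans (mul_le_mul_of_nonneg_left hSA hc₂p.le)
  rw [le_div_iff₀ (D.ip_MD_self_pos hHw hHp hx), D.ML_calA hHw.bijective hHp.bijective hz,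
    D.ip_MD hHw.bijective hHp.bijective, D.ip_MD hHw.bijective hHp.bijective,
    linInv_apply_apply hHp.bijective, mul_assoc c₂w⁻¹, ← mul_inv]
  exact le_apply_add_apply_sub (G := Hw ∘ₗ D.A) D.isPosSemidef_A hHw.isPosSemidef_linInv
    hHp.isPosSemidef_linInv (fun u => linInv_apply_apply hHw.bijective _) hρ₀ hρ₁ hc₂w
    (by positivity) (hw.linInv_apply_self_le hc₁w hc₂w.le hHw D.isPosSemidef_A) hG hz hNA

theorem ipNorm_ML_calA_div_le {c₁ : ℝ} (hc₁ : 0 < c₁) (hDA : ∀ r, c₁ * D.normDA r ≤ D.normA r)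
    (hc₁w : 0 < c₁w) (hc₁p : 0 < c₁p) (hHw : IsSPD Hw) (hHp : IsSPD Hp)
    (hw : SpectrallyEquiv c₁w c₂w Hw (linInv D.A))
    (hp : SpectrallyEquiv c₁p c₂p Hp (linInv D.Schur))
    (hG : ∀ w, D.normA (w - Hw (D.A w)) ≤ D.normA w) {x : D.X} (hx : x ≠ 0) :
    D.ipNorm (D.MD Hw Hp) (D.ML Hw Hp (D.calA x)) / D.ipNorm (D.MD Hw Hp) x ≤
      max (2 * c₁w⁻¹) (c₁p⁻¹ * (c₁ ^ 2)⁻¹ * (1 + c₁w⁻¹)) := by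
  obtain ⟨w, p⟩ := x
  have hAb := hw.bijective hc₁w hHw
  have hDA_sq (r : D.W) : D.DA r r ≤ (c₁ ^ 2)⁻¹ * D.A r r := by
    rw [le_inv_mul_iff₀ (by positivity), ← normA_sq, ← normDA_sq, ← mul_pow]
    exact pow_le_pow_left₀ (mul_nonneg hc₁.le (Real.sqrt_nonneg _)) (hDA r) 2
  have hAN (z : D.W) (q : D.Q) (hz : D.A z = D.B.flip q) :
      D.A z z ≤ c₁p⁻¹ * (c₁ ^ 2)⁻¹ * linInv Hp q q := by
    have hAS := apply_self_le_schurComplement D.isPosSemidef_DA (D.DA_bijective hAb)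
      (by positivity) hDA_sq hz
    have hSN := hp.apply_self_le hc₁p hHp q
    rw [mul_comm c₁p⁻¹, mul_assoc]
    exact hAS.trans (mul_le_mul_of_nonneg_left hSN (by positivity))
  obtain ⟨z, hz⟩ := hAb.2 (D.B.flip p)
  obtain ⟨t, ht⟩ := hAb.2 (D.B.flip (Hp (D.B (Hw (D.A (w + z)) - w))))
  have hbound := apply_self_add_apply_self_le (G := Hw ∘ₗ D.A) D.isPosSemidef_A
    hHw.isPosSemidef_linInv hHp.isPosSemidef_linInv
    (fun u => linInv_apply_apply hHw.bijective _) (inv_nonneg.2 hc₁w.le)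
    (hw.apply_self_le hc₁w hHw) hG hAN (w := w) hz ht (linInv_apply_apply hHp.bijective _)
  have hpos := D.ip_MD_self_pos hHw hHp hx
  rw [ipNorm, ipNorm, div_le_iff₀ (Real.sqrt_pos.2 hpos)]
  refine Real.sqrt_le_iff.2 ⟨by positivity, ?_⟩
  rw [mul_pow, Real.sq_sqrt hpos.le, D.ML_calA hHw.bijective hHp.bijective hz,
    D.ip_MD hHw.bijective hHp.bijective, D.ip_MD hHw.bijective hHp.bijective]
  exact hbound

end Problem

end MixedDim

theorem mainTheorem7_general (n : ℕ) :
    ∃ c₂ > 0, ∀ σ κ : ℝ, ∃ c₁ > 0, ∀ D : MixedDim.Problem n,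
      (∀ e, MixedDim.ShapeRegular σ (D.𝓣.T e)) → D.P.AnisotropyLE κ →
      (∀ r : D.W, c₁ * D.normDA r ≤ D.normA r ∧ D.normA r ≤ c₂ * D.normDA r) ∧
      ∀ (c₁w c₂w c₁p c₂p ρ : ℝ) (Hw : D.W' →ₗ[ℝ] D.W) (Hp : D.Q' →ₗ[ℝ] D.Q),
        0 < c₁w → 0 < c₂w → 0 < c₁p → 0 < c₂p → 0 ≤ ρ → ρ < 1 →
        MixedDim.IsSPD Hw → MixedDim.IsSPD Hp →
        MixedDim.SpectrallyEquiv c₁w c₂w Hw (MixedDim.linInv D.A) →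
        MixedDim.SpectrallyEquiv c₁p c₂p Hp (MixedDim.linInv D.Schur) →
        (∀ w : D.W, D.normA (w - Hw (D.A w)) ≤ ρ * D.normA w) →
        ∃ ξ₁ > 0, ∃ ξ₂ > 0,
          ξ₁ = (1 - ρ) / 2 * min c₂w⁻¹ (c₂w⁻¹ * (c₂ ^ 2)⁻¹ * c₂p⁻¹) ∧
          ξ₂ = max (2 * c₁w⁻¹) (c₁p⁻¹ * (c₁ ^ 2)⁻¹ * (1 + c₁w⁻¹)) ∧
          ∀ x : D.X, x ≠ 0 →
            ξ₁ ≤ D.ip (D.MD Hw Hp) (D.ML Hw Hp (D.calA x)) x / D.ip (D.MD Hw Hp) x x ∧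
            D.ipNorm (D.MD Hw Hp) (D.ML Hw Hp (D.calA x)) / D.ipNorm (D.MD Hw Hp) x ≤ ξ₂ := by
  have hc₂ : 0 < √((n : ℝ) + 1) := Real.sqrt_pos.2 n.cast_add_one_pos
  refine ⟨√(n + 1), hc₂, fun σ κ => ?_⟩
  have hC : 0 < √(MixedDim.Problem.lumpingConst n σ κ) :=
    Real.sqrt_pos.2 (zero_lt_one.trans_le (MixedDim.Problem.one_le_lumpingConst n σ κ))
  refine ⟨(√(MixedDim.Problem.lumpingConst n σ κ))⁻¹, inv_pos.2 hC, fun D hσ hκ => ?_⟩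
  have hDA (r : D.W) := (inv_mul_le_iff₀ hC).2 (D.normDA_le hσ hκ r)
  refine ⟨fun r => ⟨hDA r, D.normA_le r⟩, ?_⟩
  intro c₁w c₂w c₁p c₂p ρ Hw Hp hc₁w hc₂w hc₁p hc₂p hρ₀ hρ₁ hHw hHp hw hp hG
  have hG₁ (w : D.W) : D.normA (w - Hw (D.A w)) ≤ D.normA w :=
    (hG w).trans (mul_le_of_le_one_left (Real.sqrt_nonneg _) hρ₁.le)
  exact ⟨_, mul_pos (half_pos (sub_pos.2 hρ₁)) (by positivity), _, by positivity, rfl, rfl,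
    fun x hx => ⟨
      D.le_ip_ML_calA_div hc₂ D.normA_le hc₁w hc₂w hc₁p hc₂p hρ₀ hρ₁.le hHw hHp hw hp hG hx,
      D.ipNorm_ML_calA_div_le (inv_pos.2 hC) hDA hc₁w hc₁p hHw hHp hw hp hG₁ hx⟩⟩

theorem mainTheorem7 (n : ℕ) (hn : n = 2 ∨ n = 3) (σ : ℝ) :
    ∃ c₂ > 0, ∀ κ : ℝ, ∃ c₁ > 0, ∀ D : MixedDim.Problem n,
      (∀ e, MixedDim.ShapeRegular σ (D.𝓣.T e)) → D.P.AnisotropyLE κ →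
      (∀ r : D.W, c₁ * D.normDA r ≤ D.normA r ∧ D.normA r ≤ c₂ * D.normDA r) ∧
      ∀ (c₁w c₂w c₁p c₂p ρ : ℝ) (Hw : D.W' →ₗ[ℝ] D.W) (Hp : D.Q' →ₗ[ℝ] D.Q),
        0 < c₁w → 0 < c₂w → 0 < c₁p → 0 < c₂p → 0 ≤ ρ → ρ < 1 →
        MixedDim.IsSPD Hw → MixedDim.IsSPD Hp →
        MixedDim.SpectrallyEquiv c₁w c₂w Hw (MixedDim.linInv D.A) →
        MixedDim.SpectrallyEquiv c₁p c₂p Hp (MixedDim.linInv D.Schur) →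
        (∀ w : D.W, D.normA (w - Hw (D.A w)) ≤ ρ * D.normA w) →
        ∃ ξ₁ > 0, ∃ ξ₂ > 0,
          ξ₁ = (1 - ρ) / 2 * min c₂w⁻¹ (c₂w⁻¹ * (c₂ ^ 2)⁻¹ * c₂p⁻¹) ∧
          ξ₂ = max (2 * c₁w⁻¹) (c₁p⁻¹ * (c₁ ^ 2)⁻¹ * (1 + c₁w⁻¹)) ∧
          ∀ x : D.X, x ≠ 0 →
            ξ₁ ≤ D.ip (D.MD Hw Hp) (D.ML Hw Hp (D.calA x)) x / D.ip (D.MD Hw Hp) x x ∧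
            D.ipNorm (D.MD Hw Hp) (D.ML Hw Hp (D.calA x)) / D.ipNorm (D.MD Hw Hp) x ≤ ξ₂ := by
  obtain ⟨c₂, hc₂, h⟩ := mainTheorem7_general n
  exact ⟨c₂, hc₂, h σ⟩
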